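/- Let $A\in\mathbb C^{n\times n}$ have all its eigenvalues in the open unit disc, let $B\in\mathbb C^{n\times m}$ have full column rank, and let $(A,B)$ be reachable. Put $G(z)=(zI-A)^{-1}B$. All integrals are over the unit circle $\mathbb T$ with respect to $d\vartheta/2\pi$, and $G^*$ denotes the conjugate transpose of $G$ on $\mathbb T$. Let $\mathcal S_+^{m\times m}(\mathbb T)$ be the set of (classes modulo a.e. equality of) measurable Hermitian-valued functions $\Phi:\mathbb T\to\mathbb C^{m\times m}$ with $cI\le\Phi\le CI$ a.e. for some constants $0<c\le C$ depending on $\Phi$. Let $$\mathrm{Range}\,\Gamma=\Big\{\int G\Phi G^*:\ \Phi \text{ continuous on } \mathbb T \text{ with values in the Hermitian } m\times m \text{ matrices}\Big\},\qquad P_\Gamma=\{\Sigma\in\mathrm{Range}\,\Gamma:\ \Sigma>0\}.$$ For $\Phi,\Psi\in\mathcal S_+^{m\times m}(\mathbb T)$ let $$d_H(\Phi,\Psi)=\inf\big\{\|W_\Psi-W_\Phi\|_2:\ W_\Psi,W_\Phi\in L_2^{m\times m},\ W_\Psi W_\Psi^*=\Psi,\ W_\Phi W_\Phi^*=\Phi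 \text{ a.e.}\big\},\qquad \|W\|_2^2=\mathrm{tr}\int WW^*.$$ Fix $\Psi\in\mathcal S_+^{m\times m}(\mathbb T)$. Then the problem $$\text{minimize } d_H(\Phi,\Psi)\quad\text{over}\quad\Big\{\Phi\in\mathcal S_+^{m\times m}(\mathbb T):\ \int G\Phi G^*=\Sigma\Big\}$$ is well-posed in the sense of Hadamard for $\Sigma\in P_\Gamma$ and perturbations $\delta\Sigma\in\mathrm{Range}\,\Gamma$. That is, for every $\Sigma\in P_\Gamma$: 1. the problem has a solution; 2. the solution $\hat\Phi(\Sigma)$ is unique (up to a.e. equality); 3. the solution depends continuously on the datum: for every $\varepsilon>0$ there is $\delta>0$ such that for every $\delta\Sigma\in\mathrm{Range}\,\Gamma$ with $\|\delta\Sigma\|_F<\delta$ one has $\Sigma+\delta\Sigma\in P_\Gamma$ and $\|\hat\Phi(\Sigma+\delta\Sigma)-\hat\Phi(\Sigma)\|_{L_\infty}<\varepsilon$. -/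

import Mathlib

open MeasureTheory
open scoped Real ENNReal Matrix ComplexOrder

noncomputable section

namespace SpectrumApprox

instance factTwoPiPos : Fact (0 < 2 * π) := ⟨Real.two_pi_pos⟩

/-- The unit circle, parametrized by the angle `θ` modulo `2π`. -/
abbrev Torus : Type := AddCircle (2 * π)

/-- The normalized Lebesgue measure `dθ/2π` on the unit circle. -/
abbrev circleMeasure : Measure Torus := AddCircle.haarAddCircle

/-- A stability matrix (discrete time): all eigenvalues lie in the open unit disc. -/
def IsStabilityMatrix {n : ℕ} (A : Matrix (Fin n) (Fin n) ℂ) : Prop :=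
  ∀ z ∈ spectrum ℂ A, ‖z‖ < 1

/-- The pair `(A, B)` is reachable: the matrix `[B, AB, …, A^(n-1) B]` has rank `n`. -/
def IsReachable {n m : ℕ} (A : Matrix (Fin n) (Fin n) ℂ) (B : Matrix (Fin n) (Fin m) ℂ) : Prop :=
  (Matrix.of fun (i : Fin n) (p : Fin n × Fin m) => (A ^ (p.1 : ℕ) * B) i p.2).rank = n

/-- The transfer function `G(z) = (zI - A)⁻¹ B`. -/
def transferFunction {n m : ℕ} (A : Matrix (Fin n) (Fin n) ℂ) (B : Matrix (Fin n) (Fin m) ℂ)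
    (z : ℂ) : Matrix (Fin n) (Fin m) ℂ :=
  (z • (1 : Matrix (Fin n) (Fin n) ℂ) - A)⁻¹ * B

/-- The restriction of `G` to the unit circle, `θ ↦ G(e^{iθ})`. -/
def circleTransfer {n m : ℕ} (A : Matrix (Fin n) (Fin n) ℂ) (B : Matrix (Fin n) (Fin m) ℂ)
    (θ : Torus) : Matrix (Fin n) (Fin m) ℂ :=
  transferFunction A B (AddCircle.toCircle θ : ℂ)

/-- `∫ G Φ G*` over the unit circle, computed entrywise. -/
def moment {n m : ℕ} (A : Matrix (Fin n) (Fin n) ℂ) (B : Matrix (Fin n) (Fin m) ℂ)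
    (Φ : Torus → Matrix (Fin m) (Fin m) ℂ) : Matrix (Fin n) (Fin n) ℂ :=
  Matrix.of fun i j =>
    ∫ θ, (circleTransfer A B θ * Φ θ * (circleTransfer A B θ)ᴴ) i j ∂circleMeasure

/-- The range of `Γ : Φ ↦ ∫ G Φ G*` on continuous Hermitian-valued functions. -/
def rangeGamma {n m : ℕ} (A : Matrix (Fin n) (Fin n) ℂ) (B : Matrix (Fin n) (Fin m) ℂ) :
    Set (Matrix (Fin n) (Fin n) ℂ) :=
  {S | ∃ Φ : C(Torus, Matrix (Fin m) (Fin m) ℂ), (∀ θ, (Φ θ).IsHermitian) ∧ moment A B Φ = S}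

/-- The positive definite elements of the range of `Γ`. -/
def posGamma {n m : ℕ} (A : Matrix (Fin n) (Fin n) ℂ) (B : Matrix (Fin n) (Fin m) ℂ) :
    Set (Matrix (Fin n) (Fin n) ℂ) :=
  {S | S ∈ rangeGamma A B ∧ S.PosDef}

/-- The Frobenius norm of a complex matrix. -/
def frobenius {k l : ℕ} (M : Matrix (Fin k) (Fin l) ℂ) : ℝ :=
  √(∑ i, ∑ j, ‖M i j‖ ^ 2)

/-- Bounded, coercive, Hermitian-valued measurable spectral densities on the unit circle. -/
structure IsSpectralDensity {m : ℕ} (Φ : Torus → Matrix (Fin m) (Fin m) ℂ) : Prop where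
  aemeasurable : ∀ i j, AEMeasurable (fun θ => Φ θ i j) circleMeasure
  hermitian : ∀ᵐ θ ∂circleMeasure, (Φ θ).IsHermitian
  bounded : ∃ C : ℝ, ∀ᵐ θ ∂circleMeasure, frobenius (Φ θ) ≤ C
  coercive : ∃ c : ℝ, 0 < c ∧
    ∀ᵐ θ ∂circleMeasure, (Φ θ - (c : ℂ) • (1 : Matrix (Fin m) (Fin m) ℂ)).PosSemidef

/-- `W` is a square spectral factor of `Φ`: `W` is square integrable and `W W* = Φ`. -/
def IsSpectralFactor {m : ℕ} (W Φ : Torus → Matrix (Fin m) (Fin m) ℂ) : Prop :=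
  (∀ i j, MemLp (fun θ => W θ i j) 2 circleMeasure) ∧
    ∀ᵐ θ ∂circleMeasure, W θ * (W θ)ᴴ = Φ θ

/-- The `L²` distance `(tr ∫ (V - W)(V - W)*)^{1/2}`. -/
def distL2 {m : ℕ} (V W : Torus → Matrix (Fin m) (Fin m) ℂ) : ℝ :=
  √(∫ θ, frobenius (V θ - W θ) ^ 2 ∂circleMeasure)

/-- The multivariable Hellinger distance: the `L²` distance between the sets of all the square
spectral factors of `Φ` and `Ψ`. -/
def hellingerDist {m : ℕ} (Φ Ψ : Torus → Matrix (Fin m) (Fin m) ℂ) : ℝ :=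
  sInf {r : ℝ | ∃ V W : Torus → Matrix (Fin m) (Fin m) ℂ,
    IsSpectralFactor V Ψ ∧ IsSpectralFactor W Φ ∧ r = distL2 V W}

/-- The feasible set: spectral densities `Φ` with `∫ G Φ G* = S`. -/
def feasible {n m : ℕ} (A : Matrix (Fin n) (Fin n) ℂ) (B : Matrix (Fin n) (Fin m) ℂ)
    (S : Matrix (Fin n) (Fin n) ℂ) : Set (Torus → Matrix (Fin m) (Fin m) ℂ) :=
  {Φ | IsSpectralDensity Φ ∧ moment A B Φ = S}

/-- `Φ` solves: minimize `d_H(Φ, Ψ)` subject to `∫ G Φ G* = S`. -/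
def IsHellingerSolution {n m : ℕ} (A : Matrix (Fin n) (Fin n) ℂ) (B : Matrix (Fin n) (Fin m) ℂ)
    (Ψ : Torus → Matrix (Fin m) (Fin m) ℂ) (S : Matrix (Fin n) (Fin n) ℂ)
    (Φ : Torus → Matrix (Fin m) (Fin m) ℂ) : Prop :=
  Φ ∈ feasible A B S ∧ IsMinOn (fun X => hellingerDist X Ψ) (feasible A B S) Φ

/-- The `L^∞` distance of two matrix-valued functions on the circle. -/
def distLinfty {m : ℕ} (Φ Φ' : Torus → Matrix (Fin m) (Fin m) ℂ) : ℝ≥0∞ :=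
  eLpNorm (fun θ => frobenius (Φ θ - Φ' θ)) ∞ circleMeasure

end SpectrumApprox

end

/-! Duality. For Hermitian `Λ` with `Q = I + G*ΛG > 0` on the circle and for factors `V`, `W` of
`Ψ`, `Φ`, completing the square in `W` gives `‖V - W‖² = ∫ tr (W - Q⁻¹V)* Q (W - Q⁻¹V) + ∫ tr Ψ -
J_S(Λ)`, where `J_S(Λ) = ∫ tr Q⁻¹Ψ + tr ΛS`; the constraint enters only through `∫ tr G*ΛGΦ = tr ΛS`
(`distL2_sq_eq`). Hence if `Q⁻¹ΨQ⁻¹` itself has moment `S`, it is optimal, with `W = Q⁻¹V`. Any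
other optimal density has factors arbitrarily close in `L²` to such `Q⁻¹V`, so it equals `Q⁻¹ΨQ⁻¹`
a.e. (`ae_eq_candidate`).

It remains to find `Λ`. The moment equation says that the gradient of `J_S`, namely `S - ∫
GQ⁻¹ΨQ⁻¹G*`, vanishes (`dualFun_eq`). As `Λ ↦ G*ΛG` may have a kernel, `J_S` is minimized over a
complement `V` of it among the Hermitian matrices; both terms of the gradient annihilate the kernel,
so criticality along `V` suffices (`gram_candidate_eq`). A minimizer exists because sublevel sets
stay in a compact part of the domain (`exists_bounds_of_dualFun_le`). For boundedness, write `S = ∫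
GΦ₀G*` with `Φ₀` coercive, so that `tr ΛS` dominates `∫ ‖Q‖` up to constants. For distance to the
boundary, use that `Q` is Lipschitz on a one-dimensional circle: if its quadratic form in some
direction drops to `η`, it is at most `η + Lt` nearby, and `∫ tr Q⁻¹Ψ` grows like `log (1/η)`.

The coercive `Φ₀` is the maximum entropy density (`exists_isSpectralDensity_gram_eq`). The Stein
equation for `S` is turned into `S - ZSZ* = BP⁻¹B*` with `Z = A - BKA` stable; then `GΦ₀G* = SR* +
RS - S` with `R = (I - z⁻¹Z)⁻¹`, whose mean over the circle is `I`.

For continuity, `J_S` is strictly convex along `V`, so it exceeds its minimum by a fixed gap on a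
small sphere. Changing `S` by `D` adds only the linear term `tr ΛD`, so for small `D` there is still
a minimizer inside the sphere (`exists_critical_near`), and `Q⁻¹ΨQ⁻¹` is Lipschitz in `Λ` in the sup
norm. -/

noncomputable section
namespace SpectrumApprox

/-! ### Matrix inequalities: Frobenius norm, trace and Loewner order -/

section MatrixLemmas
open scoped Matrix.Norms.Frobenius

variable {k l m n : ℕ}

theorem frobenius_eq_norm (M : Matrix (Fin k) (Fin l) ℂ) : frobenius M = ‖M‖ := by
  simp [frobenius, Matrix.frobenius_norm_def, Real.sqrt_eq_rpow]

theorem norm_sq_eq_sum (M : Matrix (Fin k) (Fin l) ℂ) : ‖M‖ ^ 2 = ∑ i, ∑ j, ‖M i j‖ ^ 2 := by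
  rw [← frobenius_eq_norm, frobenius, Real.sq_sqrt (by positivity)]

theorem norm_entry_le_norm (M : Matrix (Fin k) (Fin l) ℂ) (i : Fin k) (j : Fin l) :
    ‖M i j‖ ≤ ‖M‖ := by
  refine le_of_sq_le_sq ?_ (norm_nonneg _)
  rw [norm_sq_eq_sum]
  exact (Finset.single_le_sum (f := fun j => ‖M i j‖ ^ 2) (fun _ _ => by positivity)
    (Finset.mem_univ j)).trans (Finset.single_le_sum (f := fun i => ∑ j, ‖M i j‖ ^ 2)
    (fun _ _ => by positivity) (Finset.mem_univ i))

theorem norm_sq_eq_re_trace (M : Matrix (Fin k) (Fin l) ℂ) : ‖M‖ ^ 2 = (Mᴴ * M).trace.re := by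
  rw [norm_sq_eq_sum, Finset.sum_comm]
  simp only [Matrix.trace, Matrix.diag_apply, Matrix.mul_apply, Matrix.conjTranspose_apply,
    Complex.re_sum]
  refine Finset.sum_congr rfl fun j _ => Finset.sum_congr rfl fun i _ => ?_
  rw [Complex.sq_norm, Complex.normSq_apply]
  simp

theorem norm_sq_eq_re_trace' (M : Matrix (Fin k) (Fin l) ℂ) : ‖M‖ ^ 2 = (M * Mᴴ).trace.re := by
  rw [norm_sq_eq_re_trace, Matrix.trace_mul_comm]

theorem abs_re_trace_le (M : Matrix (Fin m) (Fin m) ℂ) : |M.trace.re| ≤ m * ‖M‖ := by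
  calc |M.trace.re| ≤ ‖M.trace‖ := Complex.abs_re_le_norm _
    _ ≤ ∑ i : Fin m, ‖M i i‖ := norm_sum_le _ _
    _ ≤ ∑ _i : Fin m, ‖M‖ := Finset.sum_le_sum fun i _ => norm_entry_le_norm M i i
    _ = m * ‖M‖ := by simp

open scoped MatrixOrder in
theorem exists_eq_conjTranspose_mul_self {P : Matrix (Fin m) (Fin m) ℂ} (hP : P.PosSemidef) :
    ∃ C : Matrix (Fin m) (Fin m) ℂ, P = Cᴴ * C :=
  CStarAlgebra.nonneg_iff_eq_star_mul_self.1 hP.nonneg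

theorem re_trace_mul_nonneg {P R : Matrix (Fin m) (Fin m) ℂ} (hP : P.PosSemidef)
    (hR : R.PosSemidef) : 0 ≤ (P * R).trace.re := by
  obtain ⟨C, rfl⟩ := exists_eq_conjTranspose_mul_self hP
  have := (hR.mul_mul_conjTranspose_same C).trace_nonneg
  rw [Matrix.mul_assoc, Matrix.trace_mul_comm]
  exact (Complex.le_def.1 this).1

/-- `c ≤ M` in the Loewner order. -/
def LowerBound (c : ℝ) (M : Matrix (Fin m) (Fin m) ℂ) : Prop :=
  (M - (c : ℂ) • (1 : Matrix (Fin m) (Fin m) ℂ)).PosSemidef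

theorem isHermitian_real_smul_one (c : ℝ) :
    ((c : ℂ) • (1 : Matrix (Fin m) (Fin m) ℂ)).IsHermitian := by
  simp [Matrix.IsHermitian, Matrix.conjTranspose_smul]

theorem LowerBound.isHermitian {c : ℝ} {M : Matrix (Fin m) (Fin m) ℂ} (h : LowerBound c M) :
    M.IsHermitian := by
  simpa only [sub_add_cancel] using Matrix.IsHermitian.add h.1 (isHermitian_real_smul_one c)

theorem posSemidef_real_smul_one {c : ℝ} (hc : 0 ≤ c) :
    ((c : ℂ) • (1 : Matrix (Fin m) (Fin m) ℂ)).PosSemidef :=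
  Matrix.PosSemidef.one.smul (by exact_mod_cast hc)

theorem posDef_real_smul_one {c : ℝ} (hc : 0 < c) :
    ((c : ℂ) • (1 : Matrix (Fin m) (Fin m) ℂ)).PosDef :=
  Matrix.PosDef.one.smul (by exact_mod_cast hc)

theorem LowerBound.posDef {c : ℝ} (hc : 0 < c) {M : Matrix (Fin m) (Fin m) ℂ}
    (h : LowerBound c M) : M.PosDef := by
  simpa only [sub_add_cancel] using Matrix.PosDef.posSemidef_add h (posDef_real_smul_one hc)

theorem LowerBound.mono {c d : ℝ} (hcd : d ≤ c) {M : Matrix (Fin m) (Fin m) ℂ}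
    (h : LowerBound c M) : LowerBound d M := by
  have := h.add (posSemidef_real_smul_one (m := m) (sub_nonneg.2 hcd))
  unfold LowerBound
  convert this using 1
  push_cast
  module

theorem LowerBound.re_trace_mul_le {c : ℝ} {R P : Matrix (Fin m) (Fin m) ℂ}
    (hR : LowerBound c R) (hP : P.PosSemidef) : c * P.trace.re ≤ (P * R).trace.re := by
  have := re_trace_mul_nonneg hP hR
  simp only [mul_sub, Matrix.trace_sub, Matrix.mul_smul, Matrix.mul_one, Matrix.trace_smul,
    Complex.sub_re, smul_eq_mul, Complex.re_ofReal_mul] at this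
  linarith

theorem LowerBound.norm_sq_le {c : ℝ} {Q : Matrix (Fin m) (Fin m) ℂ} (hQ : LowerBound c Q)
    (Z : Matrix (Fin m) (Fin k) ℂ) : c * ‖Z‖ ^ 2 ≤ (Zᴴ * Q * Z).trace.re := by
  have := hQ.re_trace_mul_le (Matrix.posSemidef_self_mul_conjTranspose Z)
  rwa [← norm_sq_eq_re_trace', Matrix.mul_assoc, Matrix.trace_mul_comm] at this

theorem LowerBound.isUnit_det {c : ℝ} (hc : 0 < c) {Q : Matrix (Fin m) (Fin m) ℂ}
    (hQ : LowerBound c Q) : IsUnit Q.det :=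
  (Matrix.isUnit_iff_isUnit_det _).1 (hQ.posDef hc).isUnit

/-- Testing `norm_sq_le` on `Z = Q⁻¹` gives `c ‖Q⁻¹‖² ≤ re tr (Q⁻¹)ᴴ ≤ m ‖Q⁻¹‖`; one factor of the
norm cancels. -/
theorem LowerBound.norm_inv_le {c : ℝ} (hc : 0 < c) {Q : Matrix (Fin m) (Fin m) ℂ}
    (hQ : LowerBound c Q) : ‖Q⁻¹‖ ≤ m / c := by
  have h := hQ.norm_sq_le Q⁻¹
  rw [Matrix.mul_assoc, Matrix.mul_nonsing_inv _ (hQ.isUnit_det hc), Matrix.mul_one] at h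
  have h2 := (le_abs_self _).trans (abs_re_trace_le (Q⁻¹)ᴴ)
  rw [Matrix.frobenius_norm_conjTranspose] at h2
  rw [le_div_iff₀ hc]
  rcases (norm_nonneg Q⁻¹).eq_or_lt with h0 | h0
  · rw [← h0]; simp
  · nlinarith

theorem norm_le_re_trace {Q : Matrix (Fin m) (Fin m) ℂ} (hQ : Q.PosSemidef) :
    ‖Q‖ ≤ Q.trace.re := by
  obtain ⟨C, rfl⟩ := exists_eq_conjTranspose_mul_self hQ
  rw [← norm_sq_eq_re_trace]
  calc _ ≤ ‖Cᴴ‖ * ‖C‖ := Matrix.frobenius_norm_mul _ _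
    _ = _ := by rw [Matrix.frobenius_norm_conjTranspose, sq]

theorem posSemidef_of_re_quadForm_nonneg {M : Matrix (Fin m) (Fin m) ℂ} (hM : M.IsHermitian)
    (h : ∀ v : Fin m → ℂ, 0 ≤ (star v ⬝ᵥ (M *ᵥ v)).re) : M.PosSemidef := by
  refine .of_dotProduct_mulVec_nonneg hM fun v => ?_
  rw [Complex.le_def]
  refine ⟨h v, ?_⟩
  have := hM.im_star_dotProduct_mulVec_self v
  simpa using this.symm

theorem quadForm_eq_trace (M : Matrix (Fin m) (Fin m) ℂ) (v : Fin m → ℂ) :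
    star v ⬝ᵥ (M *ᵥ v) = (M * Matrix.vecMulVec v (star v)).trace := by
  rw [Matrix.mul_vecMulVec, Matrix.trace_vecMulVec, dotProduct_comm]

theorem vecMulVec_mul_vecMulVec_star (v : Fin m → ℂ) (M : Matrix (Fin m) (Fin m) ℂ) :
    Matrix.vecMulVec v (star v) * M * Matrix.vecMulVec v (star v) =
      (star v ⬝ᵥ (M *ᵥ v)) • Matrix.vecMulVec v (star v) := by
  rw [Matrix.mul_assoc, Matrix.mul_vecMulVec, Matrix.vecMulVec_mul_vecMulVec,
    Matrix.vecMulVec_smul]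

theorem isHermitian_vecMulVec_star (v : Fin m → ℂ) :
    (Matrix.vecMulVec v (star v))ᴴ = Matrix.vecMulVec v (star v) :=
  (Matrix.posSemidef_vecMulVec_self_star v).isHermitian

theorem norm_vecMulVec_star (v : Fin m → ℂ) :
    ‖Matrix.vecMulVec v (star v)‖ = (star v ⬝ᵥ v).re := by
  have h0 : 0 ≤ (star v ⬝ᵥ v).re := (Complex.le_def.1 (dotProduct_star_self_nonneg v)).1
  refine (sq_eq_sq₀ (norm_nonneg _) h0).1 ?_
  have h1 := vecMulVec_mul_vecMulVec_star v 1
  have him : (star v ⬝ᵥ v).im = 0 := (Complex.le_def.1 (dotProduct_star_self_nonneg v)).2.symm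
  rw [norm_sq_eq_re_trace, isHermitian_vecMulVec_star]
  rw [Matrix.mul_one, Matrix.one_mulVec] at h1
  rw [h1, Matrix.trace_smul, Matrix.trace_vecMulVec, dotProduct_comm v, smul_eq_mul,
    Complex.mul_re, him]
  ring

theorem abs_re_quadForm_le (M : Matrix (Fin m) (Fin m) ℂ) (v : Fin m → ℂ) :
    |(star v ⬝ᵥ (M *ᵥ v)).re| ≤ m * ‖M‖ * (star v ⬝ᵥ v).re := by
  rw [quadForm_eq_trace, ← norm_vecMulVec_star, mul_assoc]
  refine (abs_re_trace_le _).trans ?_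
  gcongr
  exact norm_mul_le _ _

theorem posSemidef_smul_one_sub {M : Matrix (Fin m) (Fin m) ℂ} (hM : M.IsHermitian) {C : ℝ}
    (hC : m * ‖M‖ ≤ C) : ((C : ℂ) • (1 : Matrix (Fin m) (Fin m) ℂ) - M).PosSemidef := by
  refine posSemidef_of_re_quadForm_nonneg ((isHermitian_real_smul_one C).sub hM) fun v => ?_
  have h0 : 0 ≤ (star v ⬝ᵥ v).re := (Complex.le_def.1 (dotProduct_star_self_nonneg v)).1
  have := (le_abs_self _).trans (abs_re_quadForm_le M v)
  simp only [Matrix.sub_mulVec, Matrix.smul_mulVec, Matrix.one_mulVec, dotProduct_sub,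
    dotProduct_smul, Complex.sub_re, smul_eq_mul, Complex.re_ofReal_mul]
  nlinarith

theorem LowerBound.add {c d : ℝ} {Q D : Matrix (Fin m) (Fin m) ℂ} (hQ : LowerBound c Q)
    (hD : D.IsHermitian) (hd : m * ‖D‖ ≤ c - d) : LowerBound d (Q + D) := by
  have := Matrix.PosSemidef.add hQ (posSemidef_smul_one_sub (M := -D) hD.neg (by simpa using hd))
  unfold LowerBound
  convert this using 1
  push_cast
  module

/-- Since `F(EE*)F* = 1`, one has `FRF* - c/C = F(R - c)F* + (c/C) F(C - EE*)F*`, a sum of two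
positive semidefinite matrices. -/
theorem LowerBound.conj {c C : ℝ} (hc : 0 ≤ c) (hC : 0 < C) {R F E : Matrix (Fin m) (Fin m) ℂ}
    (hR : LowerBound c R) (hFE : F * E = 1) (hE : m * ‖E * Eᴴ‖ ≤ C) :
    LowerBound (c / C) (F * R * Fᴴ) := by
  have h1 := Matrix.PosSemidef.mul_mul_conjTranspose_same hR F
  have h2 := ((posSemidef_smul_one_sub (Matrix.isHermitian_mul_conjTranspose_self E)
    hE).mul_mul_conjTranspose_same F).smul (a := ((c / C : ℝ) : ℂ))
      (by exact_mod_cast (by positivity))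
  have h3 : F * (E * Eᴴ) * Fᴴ = 1 := by
    rw [← Matrix.mul_assoc, hFE, Matrix.one_mul, ← Matrix.conjTranspose_mul, hFE,
      Matrix.conjTranspose_one]
  have h4 := h1.add h2
  unfold LowerBound
  convert h4 using 1
  have hC' : (C : ℂ) ≠ 0 := by exact_mod_cast hC.ne'
  rw [Matrix.mul_sub F ((C : ℂ) • 1), Matrix.sub_mul _ _ Fᴴ, h3, Matrix.mul_sub F R,
    Matrix.sub_mul _ _ Fᴴ, smul_sub]
  simp only [Matrix.mul_smul, Matrix.smul_mul, Matrix.mul_one, smul_smul]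
  push_cast
  rw [div_mul_cancel₀ _ hC']
  abel

theorem exists_lowerBound_of_posDef {M : Matrix (Fin m) (Fin m) ℂ} (hM : M.PosDef) :
    ∃ c : ℝ, 0 < c ∧ LowerBound c M := by
  obtain ⟨C, hC⟩ := exists_eq_conjTranspose_mul_self hM.posSemidef
  have hdet : IsUnit (Cᴴ * C).det := by
    rw [← hC]; exact (Matrix.isUnit_iff_isUnit_det _).1 hM.isUnit
  rw [Matrix.det_mul] at hdet
  have hu := (isUnit_of_mul_isUnit_left hdet)
  set E := (Cᴴ)⁻¹
  have h1 : LowerBound 1 (1 : Matrix (Fin m) (Fin m) ℂ) := by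
    simp [LowerBound, Matrix.PosSemidef.zero]
  have := h1.conj (F := Cᴴ) (E := E) (C := m * ‖E * Eᴴ‖ + 1) zero_le_one (by positivity)
    (Matrix.mul_nonsing_inv _ hu) (by linarith)
  refine ⟨_, ?_, by rw [hC]; simpa using this⟩
  positivity

/-- Lower bound for the trace of the inverse of a positive definite matrix `Q` in terms of a value
of its quadratic form. -/
theorem div_quadForm_le_re_trace_inv {c : ℝ} (hc : 0 < c) {Q : Matrix (Fin m) (Fin m) ℂ}
    (hQ : LowerBound c Q) {v : Fin m → ℂ} (hv : v ≠ 0) :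
    (star v ⬝ᵥ v).re / (star v ⬝ᵥ (Q *ᵥ v)).re ≤ (Q⁻¹).trace.re := by
  have hQd := hQ.posDef hc
  set q := (star v ⬝ᵥ (Q *ᵥ v)).re with hq
  have hq0 : 0 < q := hQd.re_dotProduct_pos hv
  have him : (star v ⬝ᵥ (Q *ᵥ v)).im = 0 := by
    simpa using hQd.isHermitian.im_star_dotProduct_mulVec_self v
  have hqc : star v ⬝ᵥ (Q *ᵥ v) = (q : ℂ) := Complex.ext rfl (by simpa using him)
  set P := Matrix.vecMulVec v (star v)
  have hdet := hQ.isUnit_det hc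
  set t : ℂ := ((q⁻¹ : ℝ) : ℂ)
  -- The left side is positive semidefinite; at `t = 1/q` the right side collapses to `Q⁻¹ - P/q`,
  -- and its trace is the claim.
  have hE : (1 - t • (P * Q)) * Q⁻¹ * (1 - t • (P * Q))ᴴ = Q⁻¹ - (2 * t) • P + (t * t * q) • P := by
    have hQH : Qᴴ = Q := hQd.isHermitian
    have hPH : Pᴴ = P := isHermitian_vecMulVec_star v
    have hPP : P * Q * P = (q : ℂ) • P := by rw [vecMulVec_mul_vecMulVec_star, hqc]
    have ht : star t = t := Complex.conj_ofReal _
    rw [Matrix.conjTranspose_sub, Matrix.conjTranspose_one, Matrix.conjTranspose_smul, ht,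
      Matrix.conjTranspose_mul, hQH, hPH, sub_mul, one_mul, mul_sub, mul_one, sub_mul,
      Matrix.smul_mul, Matrix.smul_mul, Matrix.mul_smul, Matrix.mul_smul,
      Matrix.mul_nonsing_inv_cancel_right _ _ hdet, Matrix.nonsing_inv_mul_cancel_left _ _ hdet,
      ← Matrix.mul_assoc, hPP]
    module
  have h1 := (hQd.inv.posSemidef.mul_mul_conjTranspose_same (1 - t • (P * Q))).trace_nonneg
  rw [hE] at h1
  have htq : t * t * q = t := by
    simp only [t]
    rw [← Complex.ofReal_mul, ← Complex.ofReal_mul]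
    congr 1
    field_simp
  rw [htq] at h1
  have h2 := (Complex.le_def.1 h1).1
  have htr : P.trace.re = (star v ⬝ᵥ v).re := by
    rw [Matrix.trace_vecMulVec, dotProduct_comm]
  simp only [Matrix.trace_add, Matrix.trace_sub, Matrix.trace_smul, Complex.add_re, Complex.sub_re,
    smul_eq_mul, two_mul, add_mul, t, Complex.re_ofReal_mul, htr, Complex.zero_re] at h2
  rw [div_eq_inv_mul]
  linarith

/-- Second order expansion of the inverse. -/
theorem inv_sub_inv_add_eq {Q₀ Q₁ : Matrix (Fin m) (Fin m) ℂ} (h₀ : IsUnit Q₀.det)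
    (h₁ : IsUnit Q₁.det) :
    Q₁⁻¹ = Q₀⁻¹ - Q₀⁻¹ * (Q₁ - Q₀) * Q₀⁻¹ +
      Q₀⁻¹ * (Q₁ - Q₀) * Q₁⁻¹ * (Q₁ - Q₀) * Q₀⁻¹ := by
  have e1 : Q₀⁻¹ * Q₀ = 1 := Matrix.nonsing_inv_mul _ h₀
  have e2 : Q₀ * Q₀⁻¹ = 1 := Matrix.mul_nonsing_inv _ h₀
  have e3 : Q₁⁻¹ * Q₁ = 1 := Matrix.nonsing_inv_mul _ h₁
  have e4 : Q₁ * Q₁⁻¹ = 1 := Matrix.mul_nonsing_inv _ h₁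
  generalize Q₀⁻¹ = P₀ at *
  generalize Q₁⁻¹ = P₁ at *
  have a1 : P₀ * (Q₁ - Q₀) * P₁ = P₀ - P₁ := by
    rw [mul_sub, sub_mul, mul_assoc, e4, e1, mul_one, one_mul]
  rw [a1, sub_mul, sub_mul, mul_sub P₁, e3, sub_mul, one_mul, mul_assoc P₁, e2, mul_one]
  abel

theorem inv_sub_inv_eq {Q₀ Q₁ : Matrix (Fin m) (Fin m) ℂ} (h₀ : IsUnit Q₀.det)
    (h₁ : IsUnit Q₁.det) : Q₁⁻¹ - Q₀⁻¹ = - (Q₁⁻¹ * (Q₁ - Q₀) * Q₀⁻¹) := by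
  rw [mul_sub, sub_mul, Matrix.nonsing_inv_mul _ h₁, one_mul, mul_assoc,
    Matrix.mul_nonsing_inv _ h₀, mul_one]
  abel

/-- Completing the square. -/
theorem norm_sub_sq_eq {c : ℝ} (hc : 0 < c) {Q : Matrix (Fin m) (Fin m) ℂ}
    (hQ : LowerBound c Q) (V W : Matrix (Fin m) (Fin m) ℂ) :
    ‖V - W‖ ^ 2 = ((W - Q⁻¹ * V)ᴴ * Q * (W - Q⁻¹ * V)).trace.re +
      ((V * Vᴴ).trace.re - (Q⁻¹ * (V * Vᴴ)).trace.re - ((Q - 1) * (W * Wᴴ)).trace.re) := by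
  have hdet := hQ.isUnit_det hc
  have hH : (Q⁻¹)ᴴ = Q⁻¹ := (hQ.posDef hc).inv.isHermitian
  have e1 : (W - Q⁻¹ * V)ᴴ * Q * (W - Q⁻¹ * V) =
      Wᴴ * Q * W - Wᴴ * V - Vᴴ * W + Vᴴ * Q⁻¹ * V := by
    rw [Matrix.conjTranspose_sub, Matrix.conjTranspose_mul, hH, sub_mul, sub_mul, mul_sub, mul_sub,
      Matrix.nonsing_inv_mul_cancel_right _ _ hdet, mul_assoc Wᴴ Q (Q⁻¹ * V),
      Matrix.mul_nonsing_inv_cancel_left _ _ hdet]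
    simp only [mul_assoc]
    abel
  have e2 : (V - W)ᴴ * (V - W) = Vᴴ * V - Vᴴ * W - Wᴴ * V + Wᴴ * W := by
    rw [Matrix.conjTranspose_sub, sub_mul, mul_sub, mul_sub]
    abel
  have t1 : (V * Vᴴ).trace = (Vᴴ * V).trace := Matrix.trace_mul_comm _ _
  have t2 : (Q⁻¹ * (V * Vᴴ)).trace = (Vᴴ * Q⁻¹ * V).trace := by
    rw [← mul_assoc, Matrix.trace_mul_comm, mul_assoc]
  have t3 : ((Q - 1) * (W * Wᴴ)).trace = (Wᴴ * Q * W).trace - (Wᴴ * W).trace := by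
    rw [sub_mul, one_mul, Matrix.trace_sub, Matrix.trace_mul_comm W, ← mul_assoc,
      Matrix.trace_mul_comm (Q * W), mul_assoc]
  rw [norm_sq_eq_re_trace, e1, e2, t1, t2, t3]
  simp only [Matrix.trace_add, Matrix.trace_sub, Complex.add_re, Complex.sub_re]
  ring

end MatrixLemmas

/-! ### Bounded measurable matrix functions and their moments -/

section BoundedMeasurable
open scoped Matrix.Norms.Frobenius

variable {j k l m n : ℕ}

theorem continuous_matrix_norm : Continuous fun M : Matrix (Fin k) (Fin l) ℂ => ‖M‖ := by
  simp_rw [← frobenius_eq_norm]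
  unfold frobenius
  fun_prop

/-- Essentially bounded measurable matrix-valued functions on the circle. -/
def BddMeas (f : Torus → Matrix (Fin k) (Fin l) ℂ) : Prop :=
  (∀ i j, AEStronglyMeasurable (fun θ => f θ i j) circleMeasure) ∧
    ∃ C : ℝ, ∀ᵐ θ ∂circleMeasure, ‖f θ‖ ≤ C

namespace BddMeas

theorem of_continuous {f : Torus → Matrix (Fin k) (Fin l) ℂ} (hf : Continuous f) : BddMeas f := by
  refine ⟨fun i j => (hf.matrix_elem i j).aestronglyMeasurable, ?_⟩
  obtain ⟨C, hC⟩ := isCompact_univ.bddAbove_image (continuous_matrix_norm.comp hf).continuousOn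
  exact ⟨C, .of_forall fun θ => hC ⟨θ, trivial, rfl⟩⟩

theorem const (M : Matrix (Fin k) (Fin l) ℂ) : BddMeas fun _ => M :=
  of_continuous continuous_const

theorem add {f g : Torus → Matrix (Fin k) (Fin l) ℂ} (hf : BddMeas f) (hg : BddMeas g) :
    BddMeas fun θ => f θ + g θ := by
  obtain ⟨hf, C, hC⟩ := hf
  obtain ⟨hg, D, hD⟩ := hg
  refine ⟨fun i j => (hf i j).add (hg i j), C + D, ?_⟩
  filter_upwards [hC, hD] with θ h1 h2 using (norm_add_le _ _).trans (add_le_add h1 h2)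

theorem sub {f g : Torus → Matrix (Fin k) (Fin l) ℂ} (hf : BddMeas f) (hg : BddMeas g) :
    BddMeas fun θ => f θ - g θ := by
  obtain ⟨hf, C, hC⟩ := hf
  obtain ⟨hg, D, hD⟩ := hg
  refine ⟨fun i j => (hf i j).sub (hg i j), C + D, ?_⟩
  filter_upwards [hC, hD] with θ h1 h2 using (norm_sub_le _ _).trans (add_le_add h1 h2)

theorem mul {f : Torus → Matrix (Fin k) (Fin l) ℂ} {g : Torus → Matrix (Fin l) (Fin m) ℂ}
    (hf : BddMeas f) (hg : BddMeas g) : BddMeas fun θ => f θ * g θ := by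
  obtain ⟨hf, C, hC⟩ := hf
  obtain ⟨hg, D, hD⟩ := hg
  refine ⟨fun i j => ?_, C * D, ?_⟩
  · simp only [Matrix.mul_apply]
    exact Finset.aestronglyMeasurable_fun_sum _ fun p _ => (hf i p).mul (hg p j)
  · filter_upwards [hC, hD] with θ h1 h2
    exact (Matrix.frobenius_norm_mul _ _).trans
      (mul_le_mul h1 h2 (norm_nonneg _) ((norm_nonneg _).trans h1))

theorem conjTranspose {f : Torus → Matrix (Fin k) (Fin l) ℂ} (hf : BddMeas f) :
    BddMeas fun θ => (f θ)ᴴ := by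
  obtain ⟨hf, C, hC⟩ := hf
  refine ⟨fun i j => ?_, C, ?_⟩
  · exact Complex.continuous_conj.comp_aestronglyMeasurable (hf j i)
  · filter_upwards [hC] with θ h1 using by rwa [Matrix.frobenius_norm_conjTranspose]

theorem integrable_entry {f : Torus → Matrix (Fin k) (Fin l) ℂ} (hf : BddMeas f) (i : Fin k)
    (j : Fin l) : Integrable (fun θ => f θ i j) circleMeasure := by
  obtain ⟨hf, C, hC⟩ := hf
  refine Integrable.of_bound (hf i j) C ?_
  filter_upwards [hC] with θ h using (norm_entry_le_norm _ i j).trans h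

theorem integrable_trace {f : Torus → Matrix (Fin m) (Fin m) ℂ} (hf : BddMeas f) :
    Integrable (fun θ => (f θ).trace) circleMeasure :=
  integrable_finsetSum _ fun i _ => hf.integrable_entry i i

theorem integrable_re_trace {f : Torus → Matrix (Fin m) (Fin m) ℂ} (hf : BddMeas f) :
    Integrable (fun θ => (f θ).trace.re) circleMeasure :=
  hf.integrable_trace.re

theorem integrable_norm {f : Torus → Matrix (Fin k) (Fin l) ℂ} (hf : BddMeas f) :
    Integrable (fun θ => ‖f θ‖) circleMeasure := by
  obtain ⟨hf, C, hC⟩ := hf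
  refine Integrable.of_bound (C := C) ?_ ?_
  · simp_rw [← frobenius_eq_norm]
    refine Real.continuous_sqrt.comp_aestronglyMeasurable ?_
    exact Finset.aestronglyMeasurable_fun_sum _ fun i _ =>
      Finset.aestronglyMeasurable_fun_sum _ fun j _ => (hf i j).norm.pow 2
  · filter_upwards [hC] with θ h using by rwa [norm_norm]

theorem integrable_norm_sq {f : Torus → Matrix (Fin k) (Fin l) ℂ} (hf : BddMeas f) :
    Integrable (fun θ => ‖f θ‖ ^ 2) circleMeasure := by
  simp_rw [norm_sq_eq_re_trace]
  exact (hf.conjTranspose.mul hf).integrable_re_trace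

end BddMeas

theorem IsSpectralDensity.bddMeas {Φ : Torus → Matrix (Fin m) (Fin m) ℂ}
    (h : IsSpectralDensity Φ) : BddMeas Φ := by
  refine ⟨fun i j => (h.aemeasurable i j).aestronglyMeasurable, ?_⟩
  simpa only [frobenius_eq_norm] using h.bounded

/-- The entrywise integral `∫ G Φ G*`. -/
def gram (G : Torus → Matrix (Fin n) (Fin m) ℂ) (Φ : Torus → Matrix (Fin m) (Fin m) ℂ) :
    Matrix (Fin n) (Fin n) ℂ :=
  Matrix.of fun i j => ∫ θ, (G θ * Φ θ * (G θ)ᴴ) i j ∂circleMeasure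

theorem re_trace_mul_integral {f : Torus → Matrix (Fin n) (Fin n) ℂ} (hf : BddMeas f)
    (M : Matrix (Fin n) (Fin n) ℂ) :
    (M * Matrix.of fun i j => ∫ θ, f θ i j ∂circleMeasure).trace.re =
      ∫ θ, (M * f θ).trace.re ∂circleMeasure := by
  have h : (M * Matrix.of fun i j => ∫ θ, f θ i j ∂circleMeasure).trace =
      ∫ θ, (M * f θ).trace ∂circleMeasure := by
    simp only [Matrix.trace, Matrix.diag_apply, Matrix.mul_apply, Matrix.of_apply]
    symm
    refine (integral_finsetSum _ fun i _ => integrable_finsetSum _ fun j _ =>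
      (hf.integrable_entry j i).const_mul _).trans ?_
    refine Finset.sum_congr rfl fun i _ => ?_
    refine (integral_finsetSum _ fun j _ => (hf.integrable_entry j i).const_mul _).trans ?_
    exact Finset.sum_congr rfl fun j _ => integral_const_mul _ _
  rw [h]
  exact (Complex.reCLM.integral_comp_comm ((BddMeas.const M).mul hf).integrable_trace).symm

/-- The adjoint relation: the adjoint of the moment map for the trace pairing is `M ↦ G*MG`, by
cyclicity of the trace. -/
theorem re_trace_mul_gram {G : Torus → Matrix (Fin n) (Fin m) ℂ} (hG : BddMeas G)
    {Φ : Torus → Matrix (Fin m) (Fin m) ℂ} (hΦ : BddMeas Φ) (M : Matrix (Fin n) (Fin n) ℂ) :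
    (M * gram G Φ).trace.re = ∫ θ, ((G θ)ᴴ * M * G θ * Φ θ).trace.re ∂circleMeasure := by
  refine (re_trace_mul_integral ((hG.mul hΦ).mul hG.conjTranspose) M).trans ?_
  congr with θ
  rw [← Matrix.mul_assoc, Matrix.trace_mul_comm]
  simp only [Matrix.mul_assoc]

theorem isHermitian_gram {G : Torus → Matrix (Fin n) (Fin m) ℂ}
    {Φ : Torus → Matrix (Fin m) (Fin m) ℂ} (hΦ : ∀ᵐ θ ∂circleMeasure, (Φ θ).IsHermitian) :
    (gram G Φ).IsHermitian := by
  ext i j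
  simp only [gram, Matrix.conjTranspose_apply, Matrix.of_apply]
  refine (integral_conj (𝕜 := ℂ)).symm.trans (integral_congr_ae ?_)
  filter_upwards [hΦ] with θ h
  have h2 : (G θ * Φ θ * (G θ)ᴴ).IsHermitian := Matrix.isHermitian_mul_mul_conjTranspose _ h
  exact h2.apply i j

end BoundedMeasurable

/-! ### Square roots of positive semidefinite matrices by functional calculus -/

section SquareRoot
variable {m : ℕ}
open scoped MatrixOrder Matrix.Norms.L2Operator

theorem spectrum_subset_Icc {M : Matrix (Fin m) (Fin m) ℂ} {C : ℝ} (h0 : M.PosSemidef)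
    (hC : ((C : ℂ) • (1 : Matrix (Fin m) (Fin m) ℂ) - M).PosSemidef) :
    spectrum ℝ M ⊆ Set.Icc 0 C := by
  intro x hx
  refine ⟨spectrum_nonneg_of_nonneg h0.nonneg hx, sub_nonneg.1 ?_⟩
  refine spectrum_nonneg_of_nonneg (𝕜 := ℝ) hC.nonneg ?_
  have : (C : ℂ) • (1 : Matrix (Fin m) (Fin m) ℂ) = algebraMap ℝ _ C := by
    rw [Algebra.algebraMap_eq_smul_one, Complex.coe_smul]
  rw [this, ← spectrum.singleton_sub_eq]
  exact Set.sub_mem_sub rfl hx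

/-- Serves to make a pointwise square root measurable. Continuity in the matrix needs the spectra
confined to one compact interval, and matrices are viewed as plain functions so that the product
σ-algebra is available. -/
theorem continuousOn_cfc_sqrt (C : ℝ) : ContinuousOn (Y := Fin m → Fin m → ℂ)
    (fun M : Fin m → Fin m → ℂ => (cfc Real.sqrt (Matrix.of M) : Matrix (Fin m) (Fin m) ℂ))
    {M | IsSelfAdjoint (Matrix.of M) ∧ spectrum ℝ (Matrix.of M) ⊆ Set.Icc 0 C} :=
  continuousOn_cfc (𝕜 := ℝ) (Matrix (Fin m) (Fin m) ℂ) isCompact_Icc Real.sqrt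
    Real.continuous_sqrt.continuousOn

theorem cfc_sqrt_mul_conjTranspose {M : Matrix (Fin m) (Fin m) ℂ} (h0 : M.PosSemidef) :
    cfc Real.sqrt M * (cfc Real.sqrt M)ᴴ = M := by
  have h1 : IsSelfAdjoint (cfc Real.sqrt M) := cfc_predicate _ _
  rw [← Matrix.star_eq_conjTranspose, h1.star_eq,
    ← cfc_mul _ _ M Real.continuous_sqrt.continuousOn Real.continuous_sqrt.continuousOn]
  have h2 : cfc (fun x : ℝ => x) M = M := cfc_id' ℝ M h0.isHermitian
  conv_rhs => rw [← h2]
  exact cfc_congr fun x hx => Real.mul_self_sqrt (spectrum_nonneg_of_nonneg h0.nonneg hx)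

end SquareRoot

/-! ### Existence and boundedness of spectral factors -/

section Factor
open scoped Matrix.Norms.Frobenius
variable {m : ℕ}

theorem IsSpectralDensity.exists_lowerBound {Φ : Torus → Matrix (Fin m) (Fin m) ℂ}
    (h : IsSpectralDensity Φ) : ∃ c : ℝ, 0 < c ∧ ∀ᵐ θ ∂circleMeasure, LowerBound c (Φ θ) :=
  h.coercive

theorem IsSpectralDensity.exists_isSpectralFactor {Φ : Torus → Matrix (Fin m) (Fin m) ℂ}
    (h : IsSpectralDensity Φ) : ∃ V, IsSpectralFactor V Φ := by
  obtain ⟨c, hc, hcΦ⟩ := h.exists_lowerBound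
  obtain ⟨C, hC⟩ := h.bounded
  set S : Set (Fin m → Fin m → ℂ) := {M | IsSelfAdjoint (Matrix.of M) ∧
    spectrum ℝ (Matrix.of M) ⊆ Set.Icc 0 (m * C)}
  obtain ⟨Φ', hΦ'⟩ : ∃ Φ' : Torus → Fin m → Fin m → ℂ, ∀ θ, Matrix.of (Φ' θ) = Φ θ :=
    ⟨Φ, fun _ => rfl⟩
  have hΦm : AEMeasurable Φ' circleMeasure :=
    aemeasurable_pi_lambda _ fun i => aemeasurable_pi_lambda _ fun j =>
      (h.aemeasurable i j).congr (.of_forall fun θ => by simp [← hΦ'])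
  have hS : ∀ᵐ θ ∂circleMeasure, Φ' θ ∈ S := by
    filter_upwards [hcΦ, hC] with θ h1 h2
    rw [frobenius_eq_norm] at h2
    have h3 := (h1.posDef hc)
    simp only [S, Set.mem_ofPred_eq, hΦ']
    exact ⟨h3.isHermitian, spectrum_subset_Icc h3.posSemidef
      (posSemidef_smul_one_sub h3.isHermitian (by gcongr))⟩
  obtain ⟨θ₀, hθ₀⟩ := hS.exists
  -- A modification on a null set puts every value in the set where the square root is continuous,
  -- so the composite is measurable everywhere.
  obtain ⟨g, hg, hgS, hgΦ⟩ := hΦm.exists_ae_eq_range_subset hS ⟨_, hθ₀⟩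
  have hroot : Measurable (β := Fin m → Fin m → ℂ)
      fun θ => (cfc Real.sqrt (Matrix.of (g θ)) : Matrix (Fin m) (Fin m) ℂ) :=
    (continuousOn_iff_continuous_domRestrict.1 (continuousOn_cfc_sqrt (m := m) (m * C))).measurable.comp
      (hg.subtype_mk (h := fun θ => hgS ⟨θ, rfl⟩))
  set V : Torus → Matrix (Fin m) (Fin m) ℂ := fun θ => cfc Real.sqrt (Matrix.of (g θ))
  have hVV : ∀ᵐ θ ∂circleMeasure, V θ * (V θ)ᴴ = Φ θ := by
    filter_upwards [hgΦ, hcΦ] with θ h1 h2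
    have : Matrix.of (g θ) = Φ θ := by rw [← h1, hΦ']
    simp only [V, this]
    exact cfc_sqrt_mul_conjTranspose (h2.posDef hc).posSemidef
  refine ⟨V, fun i j => ?_, hVV⟩
  have hm : AEStronglyMeasurable (fun θ => V θ i j) circleMeasure :=
    ((measurable_pi_apply j).comp ((measurable_pi_apply i).comp hroot)).aestronglyMeasurable
  refine MemLp.of_bound hm (√(m * C)) ?_
  filter_upwards [hVV, hC] with θ h1 h2
  refine (norm_entry_le_norm _ i j).trans (Real.le_sqrt_of_sq_le ?_)
  rw [norm_sq_eq_re_trace', h1]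
  rw [frobenius_eq_norm] at h2
  exact ((le_abs_self _).trans (abs_re_trace_le _)).trans (by gcongr)

/-- `‖V‖² = tr VV* = tr Φ`, so a factor of a bounded density is bounded, not merely square
integrable. -/
theorem IsSpectralFactor.bddMeas {V Φ : Torus → Matrix (Fin m) (Fin m) ℂ}
    (h : IsSpectralFactor V Φ) {C : ℝ} (hC : ∀ᵐ θ ∂circleMeasure, ‖Φ θ‖ ≤ C) :
    (∀ i j, AEStronglyMeasurable (fun θ => V θ i j) circleMeasure) ∧
      ∀ᵐ θ ∂circleMeasure, ‖V θ‖ ≤ √(m * C) := by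
  refine ⟨fun i j => (h.1 i j).1, ?_⟩
  filter_upwards [h.2, hC] with θ h1 h2
  refine Real.le_sqrt_of_sq_le ?_
  rw [norm_sq_eq_re_trace', h1]
  exact ((le_abs_self _).trans (abs_re_trace_le _)).trans (by gcongr)

end Factor

/-! ### The logarithmic barrier at the boundary of the dual domain -/

section Barrier
open scoped Matrix.Norms.Frobenius

variable {k l m n : ℕ}

/-- The starting angle `a` is free so that integration can begin at a nearly singular point. -/
theorem integral_circleMeasure (f : Torus → ℝ) (a : ℝ) :
    ∫ θ, f θ ∂circleMeasure = (2 * π)⁻¹ * ∫ t in (0 : ℝ)..2 * π, f ((a + t : ℝ) : Torus) := by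
  have h := intervalIntegral.integral_comp_add_left (fun t : ℝ => f (t : Torus)) a
    (a := 0) (b := 2 * π)
  rw [AddCircle.integral_haarAddCircle, h, add_zero,
    AddCircle.intervalIntegral_preimage (2 * π) a f, smul_eq_mul]

/-- Comparison with `∫ dt / (η + Lt)`. The bound blows up as `η → 0` with `L` fixed: a Lipschitz
function cannot nearly vanish and keep the integral of its reciprocal bounded. -/
theorem log_le_integral_inv {q : Torus → ℝ} (hq : Continuous q) (hpos : ∀ θ, 0 < q θ) (a : ℝ)
    {η L : ℝ} (hη : 0 < η) (hL : 0 < L) (h : ∀ t : ℝ, 0 ≤ t → q ((a + t : ℝ) : Torus) ≤ η + L * t) :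
    Real.log ((η + L * (2 * π)) / η) / (2 * π * L) ≤ ∫ θ, (q θ)⁻¹ ∂circleMeasure := by
  rw [integral_circleMeasure _ a]
  have hpi := Real.two_pi_pos
  have h1 : ∫ t in (0 : ℝ)..2 * π, (η + L * t)⁻¹ = L⁻¹ * Real.log ((η + L * (2 * π)) / η) := by
    rw [intervalIntegral.integral_comp_add_mul (fun x : ℝ => x⁻¹) hL.ne', mul_zero, add_zero,
      integral_inv_of_pos hη (by positivity), smul_eq_mul]
  have hq' : Continuous fun t : ℝ => (q ((a + t : ℝ) : Torus))⁻¹ := by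
    refine Continuous.inv₀ (hq.comp (AddCircle.continuous_mk' _ |>.comp ?_)) fun t => (hpos _).ne'
    fun_prop
  have h2 : ∫ t in (0 : ℝ)..2 * π, (η + L * t)⁻¹ ≤
      ∫ t in (0 : ℝ)..2 * π, (q ((a + t : ℝ) : Torus))⁻¹ := by
    refine intervalIntegral.integral_mono_on hpi.le ?_ (hq'.intervalIntegrable _ _) ?_
    · refine ContinuousOn.intervalIntegrable ?_
      rw [Set.uIcc_of_le hpi.le]
      refine ContinuousOn.inv₀ (by fun_prop) fun t ht => ?_
      have := ht.1
      positivity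
    · intro t ht
      exact inv_anti₀ (hpos _) (h t ht.1)
  rw [h1] at h2
  calc _ = (2 * π)⁻¹ * (L⁻¹ * Real.log ((η + L * (2 * π)) / η)) := by
        field_simp
    _ ≤ _ := by gcongr

theorem continuous_matrix_inv {f : Torus → Matrix (Fin m) (Fin m) ℂ} (hf : Continuous f)
    (h : ∀ θ, IsUnit (f θ).det) : Continuous fun θ => (f θ)⁻¹ := by
  have : (fun θ => (f θ)⁻¹) = fun θ => ((f θ).det)⁻¹ • (f θ).adjugate := by
    ext1 θ
    rw [Matrix.inv_def, Ring.inverse_eq_inv']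
  rw [this]
  exact (hf.matrix_det.inv₀ fun θ => (h θ).ne_zero).smul hf.matrix_adjugate

/-- A uniform lower bound for a Lipschitz function `Q` with positive definite values, in terms of
its Lipschitz constant and of the integral of `tr Q⁻¹ Ψ`. -/
theorem lowerBound_of_integral_re_trace_inv_le {Q Ψ : Torus → Matrix (Fin m) (Fin m) ℂ}
    (hQ : Continuous Q) {η₀ : ℝ} (hη₀ : 0 < η₀) (hQ₀ : ∀ θ, LowerBound η₀ (Q θ)) {L : ℝ}
    (hL : 0 ≤ L) (hQL : ∀ (θ : Torus) (t : ℝ), ‖Q (θ + t) - Q θ‖ ≤ L * |t|) (hΨ : BddMeas Ψ)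
    {c : ℝ} (hc : 0 < c) (hΨc : ∀ᵐ θ ∂circleMeasure, LowerBound c (Ψ θ)) {M : ℝ}
    (hM : ∫ θ, ((Q θ)⁻¹ * Ψ θ).trace.re ∂circleMeasure ≤ M) (θ : Torus) :
    LowerBound ((m * L + 1) * (2 * π) / Real.exp ((m * L + 1) * (2 * π) * (M / c))) (Q θ) := by
  -- The factor `m` is the loss in bounding a quadratic form by the Frobenius norm; the `1` keeps
  -- the slope positive when `L = 0`.
  set L' : ℝ := m * L + 1 with hL'
  have hL'0 : 0 < L' := by positivity
  set η : ℝ := L' * (2 * π) / Real.exp (L' * (2 * π) * (M / c)) with hη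
  have hpi := Real.two_pi_pos
  have hη0 : 0 < η := by positivity
  by_contra hcon
  have hH : (Q θ - (η : ℂ) • (1 : Matrix (Fin m) (Fin m) ℂ)).IsHermitian :=
    (hQ₀ θ).isHermitian.sub (isHermitian_real_smul_one η)
  obtain ⟨v, hv⟩ : ∃ v : Fin m → ℂ,
      (star v ⬝ᵥ ((Q θ - (η : ℂ) • (1 : Matrix (Fin m) (Fin m) ℂ)) *ᵥ v)).re < 0 := by
    by_contra! h
    exact hcon (posSemidef_of_re_quadForm_nonneg hH h)
  have hv0 : v ≠ 0 := by
    rintro rfl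
    simp at hv
  have hs : 0 < (star v ⬝ᵥ v).re := (Complex.lt_def.1 (Matrix.dotProduct_star_self_pos_iff.2 hv0)).1
  set s := (star v ⬝ᵥ v).re
  simp only [Matrix.sub_mulVec, Matrix.smul_mulVec, Matrix.one_mulVec, dotProduct_sub,
    dotProduct_smul, Complex.sub_re, smul_eq_mul, Complex.re_ofReal_mul] at hv
  set q : Torus → ℝ := fun θ => (star v ⬝ᵥ (Q θ *ᵥ v)).re / s with hq
  have hqpos : ∀ θ, 0 < q θ := fun θ => div_pos (((hQ₀ θ).posDef hη₀).re_dotProduct_pos hv0) hs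
  have hqc : Continuous q :=
    (Complex.continuous_re.comp
      (continuous_const.dotProduct (hQ.matrix_mulVec continuous_const))).div_const _
  have hqη : q θ ≤ η := by
    rw [hq, div_le_iff₀ hs]
    linarith
  obtain ⟨a, ha⟩ := QuotientAddGroup.mk_surjective θ
  have hqL : ∀ t : ℝ, 0 ≤ t → q ((a + t : ℝ) : Torus) ≤ η + L' * t := by
    intro t ht
    have h1 : ((a + t : ℝ) : Torus) = θ + t := by rw [← ha]; rfl
    rw [h1]
    have h2 := (le_abs_self _).trans (abs_re_quadForm_le (Q (θ + t) - Q θ) v)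
    rw [Matrix.sub_mulVec, dotProduct_sub, Complex.sub_re] at h2
    have h3 := hQL θ t
    rw [abs_of_nonneg ht] at h3
    have h4 : q (θ + t) - q θ ≤ m * (L * t) := by
      rw [hq]
      simp only
      rw [← sub_div, div_le_iff₀ hs]
      refine h2.trans ?_
      gcongr
    rw [hL']
    nlinarith
  have h5 := log_le_integral_inv hqc hqpos a hη0 hL'0 hqL
  have hQi : Continuous fun θ => (Q θ)⁻¹ :=
    continuous_matrix_inv hQ fun θ => (hQ₀ θ).isUnit_det hη₀
  have h6 : c * ∫ θ, (q θ)⁻¹ ∂circleMeasure ≤ M := by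
    refine le_trans ?_ hM
    rw [← integral_const_mul]
    refine integral_mono_ae ?_ ((BddMeas.of_continuous hQi).mul hΨ).integrable_re_trace ?_
    · have : Continuous fun θ => c * (q θ)⁻¹ :=
        continuous_const.mul (hqc.inv₀ fun θ => (hqpos θ).ne')
      exact this.integrable_of_hasCompactSupport (HasCompactSupport.of_compactSpace _)
    · filter_upwards [hΨc] with θ h
      refine le_trans ?_ (h.re_trace_mul_le ((hQ₀ θ).posDef hη₀).inv.posSemidef)
      gcongr
      rw [hq]
      simp only [inv_div]
      exact div_quadForm_le_re_trace_inv hη₀ (hQ₀ θ) hv0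
  -- The choice of `η` makes `2πL'/η` the exponential of the left side; the extra `η` in the
  -- numerator makes the inequality strict and contradicts the integral bound.
  have h7 : L' * (2 * π) * (M / c) < Real.log ((η + L' * (2 * π)) / η) := by
    rw [Real.lt_log_iff_exp_lt (by positivity), lt_div_iff₀ hη0]
    have : Real.exp (L' * (2 * π) * (M / c)) * η = L' * (2 * π) := by
      rw [hη]; field_simp
    linarith
  have h8 : M / c < Real.log ((η + L' * (2 * π)) / η) / (2 * π * L') := by
    rw [lt_div_iff₀ (by positivity)]
    linarith
  have h9 := h8.trans_le h5
  rw [div_lt_iff₀ hc] at h9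
  linarith

end Barrier

/-! ### The dual functional: expansion, convexity, continuity -/

section Dual
open scoped Matrix.Norms.Frobenius

variable {k l m n : ℕ}

/-- `G* Λ G`, as a function on the circle. -/
def sandwich (G : Torus → Matrix (Fin n) (Fin m) ℂ) (Λ : Matrix (Fin n) (Fin n) ℂ) (θ : Torus) :
    Matrix (Fin m) (Fin m) ℂ :=
  (G θ)ᴴ * Λ * G θ

/-- `I + G* Λ G`, as a function on the circle. -/
def pencil (G : Torus → Matrix (Fin n) (Fin m) ℂ) (Λ : Matrix (Fin n) (Fin n) ℂ) (θ : Torus) :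
    Matrix (Fin m) (Fin m) ℂ :=
  1 + sandwich G Λ θ

/-- The candidate minimizer `(I + G* Λ G)⁻¹ Ψ (I + G* Λ G)⁻¹`. -/
def candidate (G : Torus → Matrix (Fin n) (Fin m) ℂ) (Ψ : Torus → Matrix (Fin m) (Fin m) ℂ)
    (Λ : Matrix (Fin n) (Fin n) ℂ) (θ : Torus) : Matrix (Fin m) (Fin m) ℂ :=
  (pencil G Λ θ)⁻¹ * Ψ θ * (pencil G Λ θ)⁻¹

/-- The dual functional. -/
def dualFun (G : Torus → Matrix (Fin n) (Fin m) ℂ) (Ψ : Torus → Matrix (Fin m) (Fin m) ℂ)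
    (S Λ : Matrix (Fin n) (Fin n) ℂ) : ℝ :=
  ∫ θ, ((pencil G Λ θ)⁻¹ * Ψ θ).trace.re ∂circleMeasure + (Λ * S).trace.re

/-- The integral remainder of the second order expansion of the dual functional. -/
def dualRem (G : Torus → Matrix (Fin n) (Fin m) ℂ) (Ψ : Torus → Matrix (Fin m) (Fin m) ℂ)
    (Λ₀ Λ₁ : Matrix (Fin n) (Fin n) ℂ) : ℝ :=
  ∫ θ, ((pencil G Λ₀ θ)⁻¹ * sandwich G (Λ₁ - Λ₀) θ * (pencil G Λ₁ θ)⁻¹ *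
    sandwich G (Λ₁ - Λ₀) θ * (pencil G Λ₀ θ)⁻¹ * Ψ θ).trace.re ∂circleMeasure

variable {G : Torus → Matrix (Fin n) (Fin m) ℂ} {Ψ : Torus → Matrix (Fin m) (Fin m) ℂ}

theorem sandwich_add (Λ₀ Λ₁ : Matrix (Fin n) (Fin n) ℂ) (θ : Torus) :
    sandwich G (Λ₀ + Λ₁) θ = sandwich G Λ₀ θ + sandwich G Λ₁ θ := by
  simp [sandwich, Matrix.mul_add, Matrix.add_mul]

theorem sandwich_sub (Λ₀ Λ₁ : Matrix (Fin n) (Fin n) ℂ) (θ : Torus) :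
    sandwich G (Λ₀ - Λ₁) θ = sandwich G Λ₀ θ - sandwich G Λ₁ θ := by
  simp [sandwich, Matrix.mul_sub, Matrix.sub_mul]

theorem sandwich_smul (t : ℝ) (Λ : Matrix (Fin n) (Fin n) ℂ) (θ : Torus) :
    sandwich G (t • Λ) θ = t • sandwich G Λ θ := by
  simp [sandwich]

theorem sandwich_zero (θ : Torus) : sandwich G 0 θ = 0 := by
  simp [sandwich]

theorem pencil_sub_pencil (Λ₀ Λ₁ : Matrix (Fin n) (Fin n) ℂ) (θ : Torus) :
    pencil G Λ₁ θ - pencil G Λ₀ θ = sandwich G (Λ₁ - Λ₀) θ := by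
  simp [pencil, sandwich_sub]

theorem isHermitian_sandwich {Λ : Matrix (Fin n) (Fin n) ℂ} (hΛ : Λ.IsHermitian) (θ : Torus) :
    (sandwich G Λ θ).IsHermitian :=
  Matrix.isHermitian_conjTranspose_mul_mul _ hΛ

theorem continuous_sandwich (hG : Continuous G) (Λ : Matrix (Fin n) (Fin n) ℂ) :
    Continuous (sandwich G Λ) :=
  (hG.matrix_conjTranspose.matrix_mul continuous_const).matrix_mul hG

theorem continuous_pencil (hG : Continuous G) (Λ : Matrix (Fin n) (Fin n) ℂ) :
    Continuous (pencil G Λ) :=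
  continuous_const.add (continuous_sandwich hG Λ)

theorem exists_norm_le_of_continuous {f : Torus → Matrix (Fin k) (Fin l) ℂ} (hf : Continuous f) :
    ∃ C : ℝ, 0 < C ∧ ∀ θ, ‖f θ‖ ≤ C := by
  obtain ⟨C, hC⟩ := isCompact_univ.bddAbove_image (continuous_matrix_norm.comp hf).continuousOn
  exact ⟨max C 1, by positivity, fun θ => (hC ⟨θ, trivial, rfl⟩).trans (le_max_left _ _)⟩

theorem exists_norm_sandwich_le (hG : Continuous G) :
    ∃ K : ℝ, 0 < K ∧ ∀ Λ θ, ‖sandwich G Λ θ‖ ≤ K * ‖Λ‖ := by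
  obtain ⟨g, hg, hgG⟩ := exists_norm_le_of_continuous hG
  refine ⟨g * g, by positivity, fun Λ θ => ?_⟩
  calc ‖sandwich G Λ θ‖ ≤ ‖(G θ)ᴴ‖ * ‖Λ‖ * ‖G θ‖ :=
        (Matrix.frobenius_norm_mul _ _).trans
          (mul_le_mul_of_nonneg_right (Matrix.frobenius_norm_mul _ _) (norm_nonneg _))
    _ ≤ g * ‖Λ‖ * g := by
        rw [Matrix.frobenius_norm_conjTranspose]
        have := hgG θ
        gcongr
    _ = g * g * ‖Λ‖ := by ring

theorem exists_lipschitz_pencil (hG : Continuous G) {L : ℝ} (hL : 0 ≤ L)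
    (hGL : ∀ (θ : Torus) (t : ℝ), ‖G (θ + t) - G θ‖ ≤ L * |t|) :
    ∃ K : ℝ, 0 ≤ K ∧ ∀ Λ (θ : Torus) (t : ℝ),
      ‖pencil G Λ (θ + t) - pencil G Λ θ‖ ≤ K * ‖Λ‖ * |t| := by
  obtain ⟨g, hg, hgG⟩ := exists_norm_le_of_continuous hG
  refine ⟨2 * g * L, by positivity, fun Λ θ t => ?_⟩
  have h1 : pencil G Λ (θ + t) - pencil G Λ θ =
      (G (θ + t) - G θ)ᴴ * Λ * G (θ + t) + (G θ)ᴴ * Λ * (G (θ + t) - G θ) := by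
    simp only [pencil, sandwich, Matrix.conjTranspose_sub, Matrix.sub_mul, Matrix.mul_sub]
    abel
  have h3 (X : Matrix (Fin n) (Fin m) ℂ) (Y : Matrix (Fin n) (Fin m) ℂ) :
      ‖Xᴴ * Λ * Y‖ ≤ ‖X‖ * ‖Λ‖ * ‖Y‖ := by
    rw [← Matrix.frobenius_norm_conjTranspose X]
    exact (Matrix.frobenius_norm_mul _ _).trans
      (mul_le_mul_of_nonneg_right (Matrix.frobenius_norm_mul _ _) (norm_nonneg _))
  rw [h1]
  calc _ ≤ ‖G (θ + t) - G θ‖ * ‖Λ‖ * ‖G (θ + t)‖ + ‖G θ‖ * ‖Λ‖ * ‖G (θ + t) - G θ‖ :=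
        (norm_add_le _ _).trans (add_le_add (h3 _ _) (h3 _ _))
    _ ≤ (L * |t|) * ‖Λ‖ * g + g * ‖Λ‖ * (L * |t|) := by
        have := hgG θ
        have := hgG (θ + t)
        have := hGL θ t
        gcongr
    _ = _ := by ring

theorem continuous_inv_pencil (hG : Continuous G) {Λ : Matrix (Fin n) (Fin n) ℂ} {η : ℝ}
    (hη : 0 < η) (hΛ : ∀ θ, LowerBound η (pencil G Λ θ)) :
    Continuous fun θ => (pencil G Λ θ)⁻¹ :=
  continuous_matrix_inv (continuous_pencil hG Λ) fun θ => (hΛ θ).isUnit_det hη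

theorem bddMeas_candidate (hG : Continuous G) (hΨ : BddMeas Ψ) {Λ : Matrix (Fin n) (Fin n) ℂ}
    {η : ℝ} (hη : 0 < η) (hΛ : ∀ θ, LowerBound η (pencil G Λ θ)) :
    BddMeas (candidate G Ψ Λ) :=
  have h := BddMeas.of_continuous (continuous_inv_pencil hG hη hΛ)
  (h.mul hΨ).mul h

theorem bddMeas_dualRem_integrand (hG : Continuous G) (hΨ : BddMeas Ψ)
    {Λ₀ Λ₁ : Matrix (Fin n) (Fin n) ℂ} {η : ℝ} (hη : 0 < η)
    (h₀ : ∀ θ, LowerBound η (pencil G Λ₀ θ)) (h₁ : ∀ θ, LowerBound η (pencil G Λ₁ θ)) :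
    BddMeas fun θ => (pencil G Λ₀ θ)⁻¹ * sandwich G (Λ₁ - Λ₀) θ * (pencil G Λ₁ θ)⁻¹ *
      sandwich G (Λ₁ - Λ₀) θ * (pencil G Λ₀ θ)⁻¹ * Ψ θ := by
  have i₀ := BddMeas.of_continuous (continuous_inv_pencil hG hη h₀)
  have i₁ := BddMeas.of_continuous (continuous_inv_pencil hG hη h₁)
  have hD := BddMeas.of_continuous (continuous_sandwich hG (Λ₁ - Λ₀))
  exact ((((i₀.mul hD).mul i₁).mul hD).mul i₀).mul hΨ

/-- An exact second order Taylor formula, from the expansion of the inverse and cyclicity of the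
trace. It identifies the gradient as `S` minus the moment of the candidate, without differentiating
under the integral. -/
theorem dualFun_eq (hG : Continuous G) (hΨ : BddMeas Ψ) (S : Matrix (Fin n) (Fin n) ℂ)
    {Λ₀ Λ₁ : Matrix (Fin n) (Fin n) ℂ} {η : ℝ} (hη : 0 < η)
    (h₀ : ∀ θ, LowerBound η (pencil G Λ₀ θ)) (h₁ : ∀ θ, LowerBound η (pencil G Λ₁ θ)) :
    dualFun G Ψ S Λ₁ = dualFun G Ψ S Λ₀ +
      ((Λ₁ - Λ₀) * (S - gram G (candidate G Ψ Λ₀))).trace.re + dualRem G Ψ Λ₀ Λ₁ := by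
  have i₀ := BddMeas.of_continuous (continuous_inv_pencil hG hη h₀)
  have hD := BddMeas.of_continuous (continuous_sandwich hG (Λ₁ - Λ₀))
  have hc := bddMeas_candidate hG hΨ hη h₀
  have hR := bddMeas_dualRem_integrand hG hΨ hη h₀ h₁
  have key : ∫ θ, ((pencil G Λ₁ θ)⁻¹ * Ψ θ).trace.re ∂circleMeasure =
      ∫ θ, ((pencil G Λ₀ θ)⁻¹ * Ψ θ).trace.re ∂circleMeasure -
      ∫ θ, (sandwich G (Λ₁ - Λ₀) θ * candidate G Ψ Λ₀ θ).trace.re ∂circleMeasure +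
      dualRem G Ψ Λ₀ Λ₁ := by
    have hsub : Integrable (fun θ => ((pencil G Λ₀ θ)⁻¹ * Ψ θ).trace.re -
        (sandwich G (Λ₁ - Λ₀) θ * candidate G Ψ Λ₀ θ).trace.re) circleMeasure :=
      (i₀.mul hΨ).integrable_re_trace.sub (hD.mul hc).integrable_re_trace
    rw [dualRem, ← integral_sub (i₀.mul hΨ).integrable_re_trace (hD.mul hc).integrable_re_trace,
      ← integral_add hsub hR.integrable_re_trace]
    congr with θ
    conv_lhs => rw [inv_sub_inv_add_eq ((h₀ θ).isUnit_det hη) ((h₁ θ).isUnit_det hη)]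
    rw [pencil_sub_pencil, add_mul, sub_mul, Matrix.trace_add, Matrix.trace_sub, Complex.add_re, Complex.sub_re]
    congr 3
    rw [candidate, mul_assoc, mul_assoc, Matrix.trace_mul_comm]
    simp only [mul_assoc]
  have hg := re_trace_mul_gram (BddMeas.of_continuous hG) hc (Λ₁ - Λ₀)
  unfold sandwich at key
  rw [dualFun, key, ← hg, dualFun]
  simp only [mul_sub, sub_mul, Matrix.trace_sub, Complex.sub_re]
  ring

theorem exists_abs_dualRem_le (hG : Continuous G) (hΨ : BddMeas Ψ) {η : ℝ} (hη : 0 < η) :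
    ∃ C : ℝ, 0 < C ∧ ∀ Λ₀ Λ₁ : Matrix (Fin n) (Fin n) ℂ,
      (∀ θ, LowerBound η (pencil G Λ₀ θ)) → (∀ θ, LowerBound η (pencil G Λ₁ θ)) →
      |dualRem G Ψ Λ₀ Λ₁| ≤ C * ‖Λ₁ - Λ₀‖ ^ 2 := by
  obtain ⟨K, hK, hKG⟩ := exists_norm_sandwich_le hG
  obtain ⟨C, hC⟩ := hΨ.2
  have hC0 : 0 ≤ C := by
    obtain ⟨θ, hθ⟩ := hC.exists
    exact (norm_nonneg _).trans hθ
  refine ⟨m * (m / η * K * (m / η) * K * (m / η) * C) + 1, by positivity,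
    fun Λ₀ Λ₁ h₀ h₁ => ?_⟩
  have hb : ∀ᵐ θ ∂circleMeasure, ‖((pencil G Λ₀ θ)⁻¹ * sandwich G (Λ₁ - Λ₀) θ *
      (pencil G Λ₁ θ)⁻¹ * sandwich G (Λ₁ - Λ₀) θ * (pencil G Λ₀ θ)⁻¹ * Ψ θ).trace.re‖ ≤
      m * (m / η * (K * ‖Λ₁ - Λ₀‖) * (m / η) * (K * ‖Λ₁ - Λ₀‖) * (m / η) * C) := by
    filter_upwards [hC] with θ h
    refine (abs_re_trace_le _).trans ?_
    have e₀ := (h₀ θ).norm_inv_le hη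
    have e₁ := (h₁ θ).norm_inv_le hη
    have eD := hKG (Λ₁ - Λ₀) θ
    gcongr
    refine (norm_mul_le _ _).trans ?_
    gcongr
    refine (norm_mul_le _ _).trans ?_
    gcongr
    refine (norm_mul_le _ _).trans ?_
    gcongr
    refine (norm_mul_le _ _).trans ?_
    gcongr
    refine (norm_mul_le _ _).trans ?_
    gcongr
  have h2 := norm_integral_le_of_norm_le_const hb
  rw [probReal_univ, mul_one] at h2
  refine h2.trans ?_
  nlinarith [sq_nonneg ‖Λ₁ - Λ₀‖]

/-- With `D = Q₁ - Q₀` the product is `(DQ₀⁻¹)* Q₁⁻¹ (DQ₀⁻¹)`, hence positive semidefinite; a trace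
that is not positive forces `DQ₀⁻¹ = 0`. -/
theorem dualRem_integrand_eq {Λ₀ Λ₁ : Matrix (Fin n) (Fin n) ℂ} {η : ℝ} (hη : 0 < η)
    (h₀ : ∀ θ, LowerBound η (pencil G Λ₀ θ)) (h₁ : ∀ θ, LowerBound η (pencil G Λ₁ θ)) (θ : Torus) :
    ∃ P : Matrix (Fin m) (Fin m) ℂ, P.PosSemidef ∧
      ((pencil G Λ₀ θ)⁻¹ * sandwich G (Λ₁ - Λ₀) θ * (pencil G Λ₁ θ)⁻¹ *
      sandwich G (Λ₁ - Λ₀) θ * (pencil G Λ₀ θ)⁻¹ = P) ∧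
      (P.trace.re ≤ 0 → sandwich G (Λ₁ - Λ₀) θ = 0) := by
  have H₀ := ((h₀ θ).posDef hη)
  have H₁ := ((h₁ θ).posDef hη)
  set D := sandwich G (Λ₁ - Λ₀) θ with hD
  have hDH : D.IsHermitian := by
    rw [hD, ← pencil_sub_pencil]
    exact H₁.isHermitian.sub H₀.isHermitian
  set Q₀ := pencil G Λ₀ θ
  set Q₁ := pencil G Λ₁ θ
  have e : Q₀⁻¹ * D * Q₁⁻¹ * D * Q₀⁻¹ = (D * Q₀⁻¹)ᴴ * Q₁⁻¹ * (D * Q₀⁻¹) := by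
    rw [Matrix.conjTranspose_mul, hDH, H₀.inv.isHermitian]
    simp only [mul_assoc]
  refine ⟨_, H₁.inv.posSemidef.conjTranspose_mul_mul_same (D * Q₀⁻¹), e, fun h => ?_⟩
  obtain ⟨c, hc, hcQ⟩ := exists_lowerBound_of_posDef H₁.inv
  have h3 := (hcQ.norm_sq_le (D * Q₀⁻¹)).trans h
  have h4 : ‖D * Q₀⁻¹‖ ^ 2 ≤ 0 := by
    by_contra! h5
    nlinarith
  have h5 : D * Q₀⁻¹ = 0 := by
    rw [← norm_eq_zero]
    exact pow_eq_zero_iff two_ne_zero |>.1 (le_antisymm h4 (sq_nonneg _))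
  rw [← Matrix.nonsing_inv_mul_cancel_right Q₀ D ((h₀ θ).isUnit_det hη), h5, zero_mul]

/-- Strict convexity modulo the kernel of `Λ ↦ G*ΛG`: a zero integral would make `G*(Λ₁ - Λ₀)G`
vanish a.e., hence everywhere by continuity. -/
theorem dualRem_pos (hG : Continuous G) (hΨ : BddMeas Ψ) {c : ℝ} (hc : 0 < c)
    (hΨc : ∀ᵐ θ ∂circleMeasure, LowerBound c (Ψ θ))
    {Λ₀ Λ₁ : Matrix (Fin n) (Fin n) ℂ} {η : ℝ} (hη : 0 < η)
    (h₀ : ∀ θ, LowerBound η (pencil G Λ₀ θ)) (h₁ : ∀ θ, LowerBound η (pencil G Λ₁ θ))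
    (hne : ∃ θ, sandwich G (Λ₁ - Λ₀) θ ≠ 0) : 0 < dualRem G Ψ Λ₀ Λ₁ := by
  set f : Torus → ℝ := fun θ => ((pencil G Λ₀ θ)⁻¹ * sandwich G (Λ₁ - Λ₀) θ * (pencil G Λ₁ θ)⁻¹ *
      sandwich G (Λ₁ - Λ₀) θ * (pencil G Λ₀ θ)⁻¹ * Ψ θ).trace.re
  have hf : ∀ᵐ θ ∂circleMeasure, 0 ≤ f θ ∧ (f θ ≤ 0 → sandwich G (Λ₁ - Λ₀) θ = 0) := by
    filter_upwards [hΨc] with θ h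
    obtain ⟨P, hP, hPe, hP0⟩ := dualRem_integrand_eq hη h₀ h₁ θ
    simp only [f, hPe]
    have h1 := h.re_trace_mul_le hP
    have h2 := (Complex.le_def.1 hP.trace_nonneg).1
    rw [Complex.zero_re] at h2
    refine ⟨by nlinarith, fun h3 => hP0 ?_⟩
    by_contra! h4
    nlinarith
  have hint : Integrable f circleMeasure :=
    (bddMeas_dualRem_integrand hG hΨ hη h₀ h₁).integrable_re_trace
  have hnn : 0 ≤ᵐ[circleMeasure] f := hf.mono fun θ h => h.1
  refine (integral_nonneg_of_ae hnn).lt_of_ne fun h0 => ?_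
  have hz := (integral_eq_zero_iff_of_nonneg_ae hnn hint).1 h0.symm
  have hs : sandwich G (Λ₁ - Λ₀) =ᵐ[circleMeasure] fun _ => 0 := by
    filter_upwards [hf, hz] with θ h1 h2
    exact h1.2 h2.le
  have := Continuous.ae_eq_iff_eq (circleMeasure) (continuous_sandwich hG _) continuous_const
    |>.1 hs
  obtain ⟨θ, hθ⟩ := hne
  exact hθ (congrFun this θ)

theorem continuousOn_dualFun (hG : Continuous G) (hΨ : BddMeas Ψ) (S : Matrix (Fin n) (Fin n) ℂ)
    {η : ℝ} (hη : 0 < η) :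
    ContinuousOn (dualFun G Ψ S) {Λ | ∀ θ, LowerBound η (pencil G Λ θ)} := by
  intro Λ₀ h₀
  obtain ⟨C, hC, hCR⟩ := exists_abs_dualRem_le hG hΨ hη
  have h1 : Filter.Tendsto (dualRem G Ψ Λ₀)
      (nhdsWithin Λ₀ {Λ | ∀ θ, LowerBound η (pencil G Λ θ)}) (nhds 0) := by
    refine squeeze_zero_norm' (a := fun Λ₁ => C * ‖Λ₁ - Λ₀‖ ^ 2) ?_ ?_
    · filter_upwards [self_mem_nhdsWithin] with Λ₁ h₁ using hCR _ _ h₀ h₁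
    · refine Filter.Tendsto.mono_left ?_ nhdsWithin_le_nhds
      have : Continuous fun Λ₁ : Matrix (Fin n) (Fin n) ℂ => C * ‖Λ₁ - Λ₀‖ ^ 2 :=
        continuous_const.mul ((continuous_matrix_norm.comp
          (continuous_id.sub continuous_const)).pow 2)
      simpa using this.tendsto Λ₀
  have h2 : Filter.Tendsto
      (fun Λ₁ => dualFun G Ψ S Λ₀ + ((Λ₁ - Λ₀) * (S - gram G (candidate G Ψ Λ₀))).trace.re)
      (nhdsWithin Λ₀ {Λ | ∀ θ, LowerBound η (pencil G Λ θ)}) (nhds (dualFun G Ψ S Λ₀)) := by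
    refine Filter.Tendsto.mono_left ?_ nhdsWithin_le_nhds
    have : Continuous fun Λ₁ : Matrix (Fin n) (Fin n) ℂ =>
        dualFun G Ψ S Λ₀ + ((Λ₁ - Λ₀) * (S - gram G (candidate G Ψ Λ₀))).trace.re :=
      continuous_const.add (Complex.continuous_re.comp
        (((continuous_id.sub continuous_const).matrix_mul continuous_const).matrix_trace))
    simpa using this.tendsto Λ₀
  have h3 := h2.add h1
  rw [add_zero] at h3
  refine h3.congr' ?_
  filter_upwards [self_mem_nhdsWithin] with Λ₁ h₁
  exact (dualFun_eq hG hΨ S hη h₀ h₁).symm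

end Dual

/-! ### Compactness tools and the first order condition -/

section DualMinimization
open scoped Matrix.Norms.Frobenius

variable {k l m n : ℕ}

theorem isCompact_norm_le (R : ℝ) : IsCompact {Λ : Matrix (Fin k) (Fin l) ℂ | ‖Λ‖ ≤ R} := by
  have h : IsCompact (Set.univ.pi fun _ : Fin k => Set.univ.pi fun _ : Fin l =>
      Metric.closedBall (0 : ℂ) R) :=
    isCompact_univ_pi fun _ => isCompact_univ_pi fun _ => isCompact_closedBall _ _
  refine IsCompact.of_isClosed_subset (X := Matrix (Fin k) (Fin l) ℂ) h
    (isClosed_le continuous_matrix_norm continuous_const) fun Λ hΛ => ?_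
  intro i _ j _
  rw [mem_closedBall_zero_iff]
  exact (norm_entry_le_norm Λ i j).trans hΛ

theorem isClosed_lowerBound (c : ℝ) : IsClosed {M : Matrix (Fin m) (Fin m) ℂ | LowerBound c M} := by
  have h : {M : Matrix (Fin m) (Fin m) ℂ | LowerBound c M} = {M | Mᴴ = M} ∩
      ⋂ v : Fin m → ℂ, {M | 0 ≤
        (star v ⬝ᵥ ((M - (c : ℂ) • (1 : Matrix (Fin m) (Fin m) ℂ)) *ᵥ v)).re} := by
    ext M
    simp only [Set.mem_ofPred_eq, Set.mem_inter_iff, Set.mem_iInter]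
    exact ⟨fun h => ⟨h.isHermitian, fun v => Matrix.PosSemidef.re_dotProduct_nonneg h v⟩,
      fun h => posSemidef_of_re_quadForm_nonneg
        (Matrix.IsHermitian.sub h.1 (isHermitian_real_smul_one c)) h.2⟩
  rw [h]
  refine (isClosed_eq (continuous_id.matrix_conjTranspose) continuous_id).inter
    (isClosed_iInter fun v => isClosed_le continuous_const ?_)
  exact Complex.continuous_re.comp (continuous_const.dotProduct
    ((continuous_id.sub continuous_const).matrix_mulVec continuous_const))

variable {G : Torus → Matrix (Fin n) (Fin m) ℂ} {Ψ : Torus → Matrix (Fin m) (Fin m) ℂ}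

theorem isClosed_lowerBound_pencil (G : Torus → Matrix (Fin n) (Fin m) ℂ) (η : ℝ) :
    IsClosed {Λ : Matrix (Fin n) (Fin n) ℂ | ∀ θ, LowerBound η (pencil G Λ θ)} := by
  rw [Set.ofPred_forall]
  refine isClosed_iInter fun θ => (isClosed_lowerBound η).preimage ?_
  exact continuous_const.add
    ((continuous_const.matrix_mul continuous_id).matrix_mul continuous_const)

/-- On `V` the `L¹` norm of `G*ΛG` is a genuine norm, so it dominates the Frobenius norm by
compactness of the unit sphere of `V`. -/
theorem exists_mul_norm_le_integral_norm_sandwich (hG : Continuous G)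
    {V : Submodule ℝ (Matrix (Fin n) (Fin n) ℂ)}
    (hV : ∀ Λ ∈ V, (∀ θ, sandwich G Λ θ = 0) → Λ = 0) :
    ∃ κ : ℝ, 0 < κ ∧ ∀ Λ ∈ V, κ * ‖Λ‖ ≤ ∫ θ, ‖sandwich G Λ θ‖ ∂circleMeasure := by
  obtain ⟨K, hK, hKG⟩ := exists_norm_sandwich_le hG
  set N : Matrix (Fin n) (Fin n) ℂ → ℝ := fun Λ => ∫ θ, ‖sandwich G Λ θ‖ ∂circleMeasure
  have hi Λ : Integrable (fun θ => ‖sandwich G Λ θ‖) circleMeasure :=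
    (BddMeas.of_continuous (continuous_sandwich hG Λ)).integrable_norm
  have hN : Continuous N := by
    refine continuous_iff_continuousAt.2 fun Λ₀ => tendsto_iff_norm_sub_tendsto_zero.2 ?_
    have h0 : Filter.Tendsto (fun Λ => K * ‖Λ - Λ₀‖) (nhds Λ₀) (nhds 0) := by
      have : Continuous fun Λ : Matrix (Fin n) (Fin n) ℂ => K * ‖Λ - Λ₀‖ :=
        continuous_const.mul (continuous_matrix_norm.comp (continuous_id.sub continuous_const))
      simpa using this.tendsto Λ₀
    refine squeeze_zero (fun _ => norm_nonneg _) (fun Λ => ?_) h0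
    rw [← integral_sub (hi _) (hi _)]
    have h1 := norm_integral_le_of_norm_le_const (μ := circleMeasure)
      (f := fun θ => ‖sandwich G Λ θ‖ - ‖sandwich G Λ₀ θ‖) (C := K * ‖Λ - Λ₀‖)
      (.of_forall fun θ => (abs_norm_sub_norm_le _ _).trans
        (by rw [← sandwich_sub]; exact hKG _ _))
    rwa [probReal_univ, mul_one] at h1
  have hpos : ∀ Λ ∈ V, Λ ≠ 0 → 0 < N Λ := by
    intro Λ hΛ h0
    refine (integral_nonneg fun θ => norm_nonneg _).lt_of_ne fun h => h0 (hV Λ hΛ fun θ => ?_)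
    have h1 := (integral_eq_zero_iff_of_nonneg (fun θ => norm_nonneg _) (hi Λ)).1 h.symm
    have h2 := Continuous.ae_eq_iff_eq circleMeasure
      (continuous_matrix_norm.comp (continuous_sandwich hG Λ)) continuous_const |>.1 h1
    exact norm_eq_zero.1 (congrFun h2 θ)
  set Sph : Set (Matrix (Fin n) (Fin n) ℂ) := {Λ | Λ ∈ V ∧ ‖Λ‖ = 1}
  have hS : IsCompact Sph := by
    refine (isCompact_norm_le 1).of_isClosed_subset ?_ fun Λ h => h.2.le
    exact (Submodule.closed_of_finiteDimensional V).inter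
      (isClosed_eq continuous_matrix_norm continuous_const)
  have hscale : ∀ Λ ∈ V, Λ ≠ 0 → ‖Λ‖⁻¹ • Λ ∈ Sph := fun Λ hΛ h0 =>
    ⟨V.smul_mem _ hΛ, by
      rw [norm_smul, norm_inv, norm_norm, inv_mul_cancel₀ (norm_ne_zero_iff.2 h0)]⟩
  have hhom : ∀ (t : ℝ) Λ, 0 ≤ t → N (t • Λ) = t * N Λ := by
    intro t Λ ht
    simp only [N]
    rw [← integral_const_mul]
    congr with θ
    rw [sandwich_smul, norm_smul, Real.norm_of_nonneg ht]
  rcases Sph.eq_empty_or_nonempty with he | hne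
  · refine ⟨1, one_pos, fun Λ hΛ => ?_⟩
    by_cases h0 : Λ = 0
    · rw [h0, norm_zero, mul_zero]
      exact integral_nonneg fun θ => norm_nonneg _
    · have := hscale Λ hΛ h0
      rw [he] at this
      exact this.elim
  · obtain ⟨Λ₀, h₀, hmin⟩ := hS.exists_isMinOn hne hN.continuousOn
    refine ⟨N Λ₀, hpos _ h₀.1 ?_, fun Λ hΛ => ?_⟩
    · rintro rfl
      simp [Sph] at h₀
    by_cases h0 : Λ = 0
    · rw [h0, norm_zero, mul_zero]
      exact integral_nonneg fun θ => norm_nonneg _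
    · have h1 : N Λ₀ ≤ N (‖Λ‖⁻¹ • Λ) := hmin (hscale Λ hΛ h0)
      rw [hhom _ _ (by positivity), le_inv_mul_iff₀ (norm_pos_iff.2 h0)] at h1
      change _ ≤ N Λ
      linarith

/-- A lower bound for the pencil persists, up to a factor two, in a neighbourhood. -/
theorem exists_lowerBound_pencil_of_near (hG : Continuous G) {η : ℝ} (hη : 0 < η) :
    ∃ r : ℝ, 0 < r ∧ ∀ Λ₀ Λ₁ : Matrix (Fin n) (Fin n) ℂ, (Λ₁ - Λ₀).IsHermitian →
      ‖Λ₁ - Λ₀‖ ≤ r → (∀ θ, LowerBound η (pencil G Λ₀ θ)) →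
      ∀ θ, LowerBound (η / 2) (pencil G Λ₁ θ) := by
  obtain ⟨K, hK, hKG⟩ := exists_norm_sandwich_le hG
  refine ⟨η / 2 / (m * K + 1), by positivity, fun Λ₀ Λ₁ hH hr h₀ θ => ?_⟩
  have h1 : pencil G Λ₁ θ = pencil G Λ₀ θ + sandwich G (Λ₁ - Λ₀) θ := by
    rw [← pencil_sub_pencil]; abel
  rw [h1]
  refine (h₀ θ).add (isHermitian_sandwich hH θ) ?_
  rw [le_div_iff₀ (by positivity)] at hr
  have h2 := hKG (Λ₁ - Λ₀) θ
  calc _ ≤ m * (K * ‖Λ₁ - Λ₀‖) := by gcongr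
    _ ≤ _ := by linarith [norm_nonneg (Λ₁ - Λ₀)]

/-- The first order condition at a local minimum of the dual functional along `V`. -/
theorem re_trace_eq_zero_of_isLocalMin (hG : Continuous G) (hΨ : BddMeas Ψ)
    {V : Submodule ℝ (Matrix (Fin n) (Fin n) ℂ)} (hV : ∀ Λ ∈ V, Λ.IsHermitian)
    {S Λ₀ : Matrix (Fin n) (Fin n) ℂ} {η : ℝ} (hη : 0 < η)
    (h₀ : ∀ θ, LowerBound η (pencil G Λ₀ θ)) {r : ℝ} (hr : 0 < r)
    (hmin : ∀ Δ ∈ V, ‖Δ‖ < r → dualFun G Ψ S Λ₀ ≤ dualFun G Ψ S (Λ₀ + Δ)) :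
    ∀ Δ ∈ V, (Δ * (S - gram G (candidate G Ψ Λ₀))).trace.re = 0 := by
  intro Δ hΔ
  obtain ⟨C, hC, hCR⟩ := exists_abs_dualRem_le hG hΨ (half_pos hη)
  obtain ⟨ρ, hρ, hρG⟩ := exists_lowerBound_pencil_of_near hG hη
  set a := (Δ * (S - gram G (candidate G Ψ Λ₀))).trace.re with ha
  by_contra hne
  have key : ∀ t : ℝ, |t| * ‖Δ‖ < min r ρ → 0 ≤ t * a + C * (|t| * ‖Δ‖) ^ 2 := by
    intro t ht
    have hn : ‖t • Δ‖ = |t| * ‖Δ‖ := by rw [norm_smul, Real.norm_eq_abs]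
    have e : Λ₀ + t • Δ - Λ₀ = t • Δ := by abel
    have h1 := hρG Λ₀ (Λ₀ + t • Δ) (by rw [e]; exact hV _ (V.smul_mem t hΔ))
      (by rw [e, hn]; exact ht.le.trans (min_le_right _ _)) h₀
    have h0' : ∀ θ, LowerBound (η / 2) (pencil G Λ₀ θ) := fun θ => (h₀ θ).mono (by linarith)
    have h2 := dualFun_eq hG hΨ S (half_pos hη) h0' h1
    have h3 := hCR Λ₀ (Λ₀ + t • Δ) h0' h1
    have h4 := hmin (t • Δ) (V.smul_mem t hΔ) (by rw [hn]; exact ht.trans_le (min_le_left _ _))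
    rw [e, hn] at h3
    rw [e, Matrix.smul_mul, Matrix.trace_smul, Complex.smul_re, ← ha, smul_eq_mul] at h2
    linarith [le_abs_self (dualRem G Ψ Λ₀ (Λ₀ + t • Δ))]
  -- A gradient step `t = -sa`: the first bound keeps `tΔ` in the admissible ball, the second makes
  -- the quadratic term less than half of the linear gain `sa²`.
  set s : ℝ := min (min r ρ / (2 * (|a| * ‖Δ‖ + 1))) (1 / (2 * (C * ‖Δ‖ ^ 2 + 1))) with hs
  have hs0 : 0 < s := by positivity
  have hs1 : s * (2 * (|a| * ‖Δ‖ + 1)) ≤ min r ρ := by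
    rw [← le_div_iff₀ (by positivity)]; exact min_le_left _ _
  have hs2 : s * (2 * (C * ‖Δ‖ ^ 2 + 1)) ≤ 1 := by
    rw [← le_div_iff₀ (by positivity)]; exact min_le_right _ _
  have habs : |-(s * a)| = s * |a| := by rw [abs_neg, abs_mul, abs_of_pos hs0]
  have h := key (-(s * a)) (by
    rw [habs]
    have : 0 ≤ |a| * ‖Δ‖ := by positivity
    nlinarith)
  rw [habs] at h
  have h5 : (s * |a| * ‖Δ‖) ^ 2 = s * a ^ 2 * (s * ‖Δ‖ ^ 2) := by
    rw [mul_pow, mul_pow, sq_abs]; ring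
  rw [h5] at h
  have hpos : 0 < s * a ^ 2 := by positivity
  nlinarith

end DualMinimization

/-! ### Existence and stability of critical points -/

section CriticalPoints
open scoped Matrix.Norms.Frobenius

variable {k l m n : ℕ}
variable {G : Torus → Matrix (Fin n) (Fin m) ℂ} {Ψ : Torus → Matrix (Fin m) (Fin m) ℂ}

theorem pencil_zero (θ : Torus) : pencil G 0 θ = 1 := by
  simp [pencil, sandwich_zero]

theorem lowerBound_pencil_zero (θ : Torus) : LowerBound 1 (pencil G 0 θ) := by
  simp [pencil_zero, LowerBound, Matrix.PosSemidef.zero]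

/-- Coercivity of the linear term: for `S = ∫ GΦ₀G*`, `tr ΛS = ∫ tr QΦ₀ - ∫ tr Φ₀`, while `tr QΦ₀ ≥
c tr Q ≥ c ‖Q‖` for `Q ≥ 0`. -/
theorem mul_integral_norm_le_re_trace_mul_gram (hG : Continuous G)
    {Φ₀ : Torus → Matrix (Fin m) (Fin m) ℂ} (hΦ₀ : BddMeas Φ₀) {c : ℝ} (hc : 0 < c)
    (hΦ₀c : ∀ᵐ θ ∂circleMeasure, LowerBound c (Φ₀ θ)) {Λ : Matrix (Fin n) (Fin n) ℂ}
    (hΛ : ∀ θ, (pencil G Λ θ).PosSemidef) :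
    c * (∫ θ, ‖pencil G Λ θ‖ ∂circleMeasure) - ∫ θ, (Φ₀ θ).trace.re ∂circleMeasure ≤
      (Λ * gram G Φ₀).trace.re := by
  have hP := BddMeas.of_continuous (continuous_pencil hG Λ)
  have h1 : (Λ * gram G Φ₀).trace.re = ∫ θ, (pencil G Λ θ * Φ₀ θ).trace.re ∂circleMeasure -
      ∫ θ, (Φ₀ θ).trace.re ∂circleMeasure := by
    rw [re_trace_mul_gram (BddMeas.of_continuous hG) hΦ₀,
      ← integral_sub (hP.mul hΦ₀).integrable_re_trace hΦ₀.integrable_re_trace]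
    congr with θ
    rw [pencil, sandwich, add_mul, one_mul, Matrix.trace_add, Complex.add_re]
    ring
  rw [h1]
  gcongr
  rw [← integral_const_mul]
  refine integral_mono_ae (hP.integrable_norm.const_mul c) (hP.mul hΦ₀).integrable_re_trace ?_
  filter_upwards [hΦ₀c] with θ h
  refine le_trans ?_ (h.re_trace_mul_le (hΛ θ))
  have := norm_le_re_trace (hΛ θ)
  gcongr

/-- Compactness of the sublevel set of the dual functional. -/
theorem exists_bounds_of_dualFun_le (hG : Continuous G) {L : ℝ} (hL : 0 ≤ L)
    (hGL : ∀ (θ : Torus) (t : ℝ), ‖G (θ + t) - G θ‖ ≤ L * |t|) (hΨ : BddMeas Ψ) {c : ℝ}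
    (hc : 0 < c) (hΨc : ∀ᵐ θ ∂circleMeasure, LowerBound c (Ψ θ))
    {V : Submodule ℝ (Matrix (Fin n) (Fin n) ℂ)}
    (hV0 : ∀ Λ ∈ V, (∀ θ, sandwich G Λ θ = 0) → Λ = 0)
    {Φ₀ : Torus → Matrix (Fin m) (Fin m) ℂ} (hΦ₀ : BddMeas Φ₀) {c₀ : ℝ} (hc₀ : 0 < c₀)
    (hΦ₀c : ∀ᵐ θ ∂circleMeasure, LowerBound c₀ (Φ₀ θ)) (M : ℝ) :
    ∃ R η : ℝ, 0 < η ∧ ∀ Λ ∈ V, (∃ η₀ : ℝ, 0 < η₀ ∧ ∀ θ, LowerBound η₀ (pencil G Λ θ)) →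
      dualFun G Ψ (gram G Φ₀) Λ ≤ M → ‖Λ‖ ≤ R ∧ ∀ θ, LowerBound η (pencil G Λ θ) := by
  obtain ⟨κ, hκ, hκV⟩ := exists_mul_norm_le_integral_norm_sandwich hG hV0
  obtain ⟨K, hK, hKG⟩ := exists_lipschitz_pencil hG hL hGL
  set T := ∫ θ, (Φ₀ θ).trace.re ∂circleMeasure
  -- From `c₀ ∫ ‖Q‖ ≤ M + T` and `κ‖Λ‖ ≤ ∫ ‖Q‖ + ‖1‖`. Once `‖Λ‖ ≤ R`, the pencil has Lipschitz
  -- constant `KR`, and `∫ tr Q⁻¹Ψ ≤ M + T` feeds the barrier estimate that supplies `η`.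
  set R := max (((M + T) / c₀ + ‖(1 : Matrix (Fin m) (Fin m) ℂ)‖) / κ) 0
  have hKR : 0 ≤ K * R := mul_nonneg hK (le_max_right _ _)
  refine ⟨R, (m * (K * R) + 1) * (2 * π) / Real.exp ((m * (K * R) + 1) * (2 * π) * ((M + T) / c)),
    by positivity, fun Λ hΛ ⟨η₀, hη₀, hΛ₀⟩ hle => ?_⟩
  have hP := BddMeas.of_continuous (continuous_pencil hG Λ)
  have hD := BddMeas.of_continuous (continuous_sandwich hG Λ)
  have h1 := mul_integral_norm_le_re_trace_mul_gram hG hΦ₀ hc₀ hΦ₀c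
    fun θ => ((hΛ₀ θ).posDef hη₀).posSemidef
  have h2 : 0 ≤ ∫ θ, ((pencil G Λ θ)⁻¹ * Ψ θ).trace.re ∂circleMeasure := by
    refine integral_nonneg_of_ae ?_
    filter_upwards [hΨc] with θ h
    exact re_trace_mul_nonneg ((hΛ₀ θ).posDef hη₀).inv.posSemidef (h.posDef hc).posSemidef
  have h3 : ∫ θ, ‖sandwich G Λ θ‖ ∂circleMeasure ≤
      ∫ θ, ‖pencil G Λ θ‖ ∂circleMeasure + ‖(1 : Matrix (Fin m) (Fin m) ℂ)‖ := by
    have e : ∫ _θ : Torus, ‖(1 : Matrix (Fin m) (Fin m) ℂ)‖ ∂circleMeasure =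
      ‖(1 : Matrix (Fin m) (Fin m) ℂ)‖ := by simp
    rw [← e, ← integral_add hP.integrable_norm (integrable_const _)]
    refine integral_mono hD.integrable_norm (hP.integrable_norm.add (integrable_const _))
      fun θ => ?_
    have : sandwich G Λ θ = pencil G Λ θ - 1 := by simp [pencil]
    simp only [this]
    exact norm_sub_le _ _
  have h4 : 0 ≤ ∫ θ, ‖pencil G Λ θ‖ ∂circleMeasure := integral_nonneg fun θ => norm_nonneg _
  have h5 := hκV Λ hΛ
  unfold dualFun at hle
  have hR : ‖Λ‖ ≤ R := by
    refine le_trans ?_ (le_max_left _ _)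
    rw [le_div_iff₀ hκ, ← sub_le_iff_le_add, le_div_iff₀ hc₀]
    nlinarith
  refine ⟨hR, lowerBound_of_integral_re_trace_inv_le (L := K * R) (M := M + T)
    (continuous_pencil hG Λ) hη₀ hΛ₀ hKR (fun θ t => ?_) hΨ hc hΨc ?_⟩
  · refine (hKG Λ θ t).trans ?_
    gcongr
  · nlinarith

/-- The sublevel set of level `dualFun G Ψ S 0` lies in a compact set on which the functional is
continuous. The minimizer there is a local minimum along `V`, since lower bounds on the pencil
survive small perturbations. -/
theorem exists_critical (hG : Continuous G) {L : ℝ} (hL : 0 ≤ L)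
    (hGL : ∀ (θ : Torus) (t : ℝ), ‖G (θ + t) - G θ‖ ≤ L * |t|) (hΨ : BddMeas Ψ) {c : ℝ}
    (hc : 0 < c) (hΨc : ∀ᵐ θ ∂circleMeasure, LowerBound c (Ψ θ))
    {V : Submodule ℝ (Matrix (Fin n) (Fin n) ℂ)} (hV : ∀ Λ ∈ V, Λ.IsHermitian)
    (hV0 : ∀ Λ ∈ V, (∀ θ, sandwich G Λ θ = 0) → Λ = 0)
    {Φ₀ : Torus → Matrix (Fin m) (Fin m) ℂ} (hΦ₀ : BddMeas Φ₀) {c₀ : ℝ} (hc₀ : 0 < c₀)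
    (hΦ₀c : ∀ᵐ θ ∂circleMeasure, LowerBound c₀ (Φ₀ θ)) :
    ∃ Λ ∈ V, ∃ η : ℝ, 0 < η ∧ (∀ θ, LowerBound η (pencil G Λ θ)) ∧
      ∀ Δ ∈ V, (Δ * (gram G Φ₀ - gram G (candidate G Ψ Λ))).trace.re = 0 := by
  set S := gram G Φ₀
  obtain ⟨R, η, hη, hb⟩ := exists_bounds_of_dualFun_le hG hL hGL hΨ hc hΨc hV0 hΦ₀ hc₀ hΦ₀c
    (dualFun G Ψ S 0)
  set Adm : Set (Matrix (Fin n) (Fin n) ℂ) := {Λ | ∀ θ, LowerBound η (pencil G Λ θ)} with hAdm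
  set K : Set (Matrix (Fin n) (Fin n) ℂ) := ({Λ | ‖Λ‖ ≤ R} ∩ V) ∩ Adm
  have hK : IsCompact K :=
    ((isCompact_norm_le R).inter_right (Submodule.closed_of_finiteDimensional V)).inter_right
      (isClosed_lowerBound_pencil G η)
  have hmem : ∀ Λ ∈ V, (∃ η₀ : ℝ, 0 < η₀ ∧ ∀ θ, LowerBound η₀ (pencil G Λ θ)) →
      dualFun G Ψ S Λ ≤ dualFun G Ψ S 0 → Λ ∈ K := fun Λ hΛ h0 hle =>
    have := hb Λ hΛ h0 hle
    ⟨⟨this.1, hΛ⟩, this.2⟩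
  have h0K : 0 ∈ K := hmem 0 V.zero_mem ⟨1, one_pos, lowerBound_pencil_zero⟩ le_rfl
  obtain ⟨Λ, hΛ, hmin⟩ := hK.exists_isMinOn ⟨0, h0K⟩
    ((continuousOn_dualFun hG hΨ S hη).mono Set.inter_subset_right)
  obtain ⟨r, hr, hrG⟩ := exists_lowerBound_pencil_of_near hG hη
  refine ⟨Λ, hΛ.1.2, η, hη, hΛ.2, re_trace_eq_zero_of_isLocalMin hG hΨ hV hη hΛ.2 hr ?_⟩
  intro Δ hΔ hΔr
  have e : Λ + Δ - Λ = Δ := by abel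
  -- A neighbour may leave the compact set, but only if its value exceeds that at `0`, which is
  -- already at least the minimum.
  rcases le_total (dualFun G Ψ S (Λ + Δ)) (dualFun G Ψ S 0) with h | h
  · refine hmin (hmem _ (V.add_mem hΛ.1.2 hΔ) ⟨η / 2, half_pos hη, hrG Λ _ ?_ ?_ hΛ.2⟩ h)
    · rw [e]; exact hV _ hΔ
    · rw [e]; exact hΔr.le
  · exact (hmin h0K).trans h

/-- Critical points of the dual functional depend continuously on the datum. -/
theorem exists_critical_near (hG : Continuous G) (hΨ : BddMeas Ψ) {c : ℝ}
    (hc : 0 < c) (hΨc : ∀ᵐ θ ∂circleMeasure, LowerBound c (Ψ θ))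
    {V : Submodule ℝ (Matrix (Fin n) (Fin n) ℂ)} (hV : ∀ Λ ∈ V, Λ.IsHermitian)
    (hV0 : ∀ Λ ∈ V, (∀ θ, sandwich G Λ θ = 0) → Λ = 0)
    {S Λ₀ : Matrix (Fin n) (Fin n) ℂ} (hΛ₀ : Λ₀ ∈ V) {η : ℝ} (hη : 0 < η)
    (h₀ : ∀ θ, LowerBound η (pencil G Λ₀ θ))
    (hcrit : ∀ Δ ∈ V, (Δ * (S - gram G (candidate G Ψ Λ₀))).trace.re = 0) {ε : ℝ} (hε : 0 < ε) :
    ∃ δ : ℝ, 0 < δ ∧ ∀ D : Matrix (Fin n) (Fin n) ℂ, ‖D‖ < δ →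
      ∃ Λ ∈ V, ‖Λ - Λ₀‖ ≤ ε ∧ (∀ θ, LowerBound (η / 2) (pencil G Λ θ)) ∧
        ∀ Δ ∈ V, (Δ * (S + D - gram G (candidate G Ψ Λ))).trace.re = 0 := by
  obtain ⟨r, hr, hrG⟩ := exists_lowerBound_pencil_of_near hG hη
  set ρ := min ε r with hρ
  have hρ0 : 0 < ρ := lt_min hε hr
  have hη2 := half_pos hη
  have h₀' : ∀ θ, LowerBound (η / 2) (pencil G Λ₀ θ) := fun θ => (h₀ θ).mono (by linarith)
  have hnear : ∀ Λ ∈ V, ‖Λ - Λ₀‖ ≤ ρ → ∀ θ, LowerBound (η / 2) (pencil G Λ θ) :=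
    fun Λ hΛ h => hrG Λ₀ Λ (hV _ (V.sub_mem hΛ hΛ₀)) (h.trans (min_le_right _ _)) h₀
  have hcn : Continuous fun Λ : Matrix (Fin n) (Fin n) ℂ => ‖Λ - Λ₀‖ :=
    continuous_matrix_norm.comp (continuous_id.sub continuous_const)
  have hVc : IsClosed (V : Set (Matrix (Fin n) (Fin n) ℂ)) := Submodule.closed_of_finiteDimensional V
  set B : Set (Matrix (Fin n) (Fin n) ℂ) := {Λ | Λ ∈ V ∧ ‖Λ - Λ₀‖ ≤ ρ}
  have hBc : IsCompact B := by
    refine (isCompact_norm_le (‖Λ₀‖ + ρ)).of_isClosed_subset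
      (hVc.inter (isClosed_le hcn continuous_const)) fun Λ h => ?_
    have := norm_le_norm_add_norm_sub' Λ Λ₀
    exact this.trans (by gcongr; exact h.2)
  set Sp : Set (Matrix (Fin n) (Fin n) ℂ) := {Λ | Λ ∈ V ∧ ‖Λ - Λ₀‖ = ρ}
  have hSB : Sp ⊆ B := fun Λ h => ⟨h.1, h.2.le⟩
  have hSc : IsCompact Sp :=
    hBc.of_isClosed_subset (hVc.inter (isClosed_eq hcn continuous_const)) hSB
  have hBadm : B ⊆ {Λ | ∀ θ, LowerBound (η / 2) (pencil G Λ θ)} := fun Λ h => hnear Λ h.1 h.2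
  have hstrict : ∀ Λ ∈ Sp, dualFun G Ψ S Λ₀ < dualFun G Ψ S Λ := by
    intro Λ h
    rw [dualFun_eq hG hΨ S hη2 h₀' (hBadm (hSB h)), hcrit _ (V.sub_mem h.1 hΛ₀)]
    have := dualRem_pos hG hΨ hc hΨc hη2 h₀' (hBadm (hSB h)) (by
      by_contra! h1
      have h2 := hV0 _ (V.sub_mem h.1 hΛ₀) h1
      have h3 := h.2
      rw [h2, norm_zero] at h3
      exact hρ0.ne h3)
    linarith
  obtain ⟨γ, hγ, hγS⟩ : ∃ γ : ℝ, 0 < γ ∧ ∀ Λ ∈ Sp, dualFun G Ψ S Λ₀ + γ ≤ dualFun G Ψ S Λ := by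
    rcases Sp.eq_empty_or_nonempty with he | hne
    · exact ⟨1, one_pos, fun Λ h => by rw [he] at h; exact h.elim⟩
    · obtain ⟨Λ₁, h₁, hmin⟩ := hSc.exists_isMinOn hne
        ((continuousOn_dualFun hG hΨ S hη2).mono (hSB.trans hBadm))
      refine ⟨dualFun G Ψ S Λ₁ - dualFun G Ψ S Λ₀, sub_pos.2 (hstrict _ h₁), fun Λ h => ?_⟩
      have : dualFun G Ψ S Λ₁ ≤ dualFun G Ψ S Λ := hmin h
      linarith
  -- On the sphere of radius `ρ` the perturbation `tr (Λ - Λ₀)D` is at most `nρ‖D‖ < γ`, so the gap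
  -- keeps the minimum over the ball off the sphere.
  refine ⟨γ / (n * ρ + 1), by positivity, fun D hD => ?_⟩
  obtain ⟨Λ, hΛ, hmin⟩ := hBc.exists_isMinOn ⟨Λ₀, hΛ₀, by simpa using hρ0.le⟩
    ((continuousOn_dualFun hG hΨ (S + D) hη2).mono hBadm)
  have hsplit : ∀ Λ, dualFun G Ψ (S + D) Λ = dualFun G Ψ S Λ + (Λ * D).trace.re := by
    intro Λ
    simp only [dualFun, mul_add, Matrix.trace_add, Complex.add_re]
    ring
  have hlt : ‖Λ - Λ₀‖ < ρ := by
    refine hΛ.2.lt_of_ne fun heq => ?_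
    have h1 : dualFun G Ψ (S + D) Λ ≤ dualFun G Ψ (S + D) Λ₀ :=
      hmin ⟨hΛ₀, by simpa using hρ0.le⟩
    rw [hsplit, hsplit] at h1
    have h2 := hγS Λ ⟨hΛ.1, heq⟩
    have h3 := (neg_le_abs _).trans (abs_re_trace_le ((Λ - Λ₀) * D))
    have h4 : ‖(Λ - Λ₀) * D‖ ≤ ρ * ‖D‖ := heq ▸ norm_mul_le _ _
    rw [sub_mul, Matrix.trace_sub, Complex.sub_re] at h3
    rw [lt_div_iff₀ (by positivity)] at hD
    have h5 : (n : ℝ) * ‖Λ * D - Λ₀ * D‖ ≤ n * (ρ * ‖D‖) := by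
      rw [← sub_mul]; gcongr
    have h6 := norm_nonneg D
    linarith
  refine ⟨Λ, hΛ.1, hΛ.2.trans (min_le_left _ _), hBadm hΛ,
    re_trace_eq_zero_of_isLocalMin hG hΨ hV hη2 (hBadm hΛ) (sub_pos.2 hlt) fun Δ hΔ hΔr => ?_⟩
  refine hmin ⟨V.add_mem hΛ.1 hΔ, ?_⟩
  have e : Λ + Δ - Λ₀ = (Λ - Λ₀) + Δ := by abel
  rw [e]
  exact (norm_add_le _ _).trans (by linarith)

end CriticalPoints

/-! ### Optimality and uniqueness for the Hellinger problem -/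

section Hellinger
open scoped Matrix.Norms.Frobenius

variable {k l m n : ℕ}
variable {G : Torus → Matrix (Fin n) (Fin m) ℂ} {Ψ : Torus → Matrix (Fin m) (Fin m) ℂ}

theorem isSpectralDensity_candidate (hG : Continuous G) (hΨ : IsSpectralDensity Ψ)
    {Λ : Matrix (Fin n) (Fin n) ℂ} {η : ℝ} (hη : 0 < η)
    (hΛ : ∀ θ, LowerBound η (pencil G Λ θ)) : IsSpectralDensity (candidate G Ψ Λ) := by
  obtain ⟨c, hc, hΨc⟩ := hΨ.exists_lowerBound
  obtain ⟨C, hC, hCQ⟩ := exists_norm_le_of_continuous (continuous_pencil hG Λ)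
  have hb := bddMeas_candidate hG hΨ.bddMeas hη hΛ
  have hlow : ∀ᵐ θ ∂circleMeasure, LowerBound (c / (m * (C * C) + 1)) (candidate G Ψ Λ θ) := by
    filter_upwards [hΨc] with θ h
    have hH : (pencil G Λ θ)ᴴ = pencil G Λ θ := (hΛ θ).isHermitian
    have hHi : ((pencil G Λ θ)⁻¹)ᴴ = (pencil G Λ θ)⁻¹ := ((hΛ θ).posDef hη).inv.isHermitian
    have := h.conj (F := (pencil G Λ θ)⁻¹) (E := pencil G Λ θ) (C := m * (C * C) + 1) hc.le
      (by positivity) (Matrix.nonsing_inv_mul _ ((hΛ θ).isUnit_det hη)) (by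
        rw [hH]
        have h1 := norm_mul_le (pencil G Λ θ) (pencil G Λ θ)
        have h2 := hCQ θ
        have h3 : ‖pencil G Λ θ * pencil G Λ θ‖ ≤ C * C := h1.trans (by gcongr)
        have : (m : ℝ) * ‖pencil G Λ θ * pencil G Λ θ‖ ≤ m * (C * C) := by gcongr
        linarith)
    rwa [hHi] at this
  refine ⟨fun i j => (hb.1 i j).aemeasurable, hlow.mono fun θ h => h.isHermitian, ?_, _, ?_, hlow⟩
  · simpa only [frobenius_eq_norm] using hb.2
  · positivity

/-- The optimal value of the Hellinger approximation problem. -/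
def hellingerValue (G : Torus → Matrix (Fin n) (Fin m) ℂ) (Ψ : Torus → Matrix (Fin m) (Fin m) ℂ)
    (Λ S : Matrix (Fin n) (Fin n) ℂ) : ℝ :=
  ∫ θ, ((Ψ θ).trace.re - ((pencil G Λ θ)⁻¹ * Ψ θ).trace.re) ∂circleMeasure - (Λ * S).trace.re

theorem IsSpectralFactor.bddMeas_of_isSpectralDensity {V Φ : Torus → Matrix (Fin m) (Fin m) ℂ}
    (h : IsSpectralFactor V Φ) (hΦ : IsSpectralDensity Φ) : BddMeas V := by
  obtain ⟨C, hC⟩ := hΦ.bddMeas.2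
  have := h.bddMeas hC
  exact ⟨this.1, _, this.2⟩

theorem distL2_sq (V W : Torus → Matrix (Fin m) (Fin m) ℂ) :
    distL2 V W ^ 2 = ∫ θ, ‖V θ - W θ‖ ^ 2 ∂circleMeasure := by
  simp only [distL2, frobenius_eq_norm]
  exact Real.sq_sqrt (integral_nonneg fun θ => by positivity)

/-- The pointwise completed square, integrated. The second term depends on `Φ` only through its
moment `S`, which gives weak duality and measures the failure of `W = Q⁻¹V`. -/
theorem distL2_sq_eq (hG : Continuous G) (hΨ : IsSpectralDensity Ψ)
    {Λ S : Matrix (Fin n) (Fin n) ℂ} {η : ℝ} (hη : 0 < η)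
    (hΛ : ∀ θ, LowerBound η (pencil G Λ θ)) {Φ V W : Torus → Matrix (Fin m) (Fin m) ℂ}
    (hΦ : IsSpectralDensity Φ) (hΦS : gram G Φ = S) (hV : IsSpectralFactor V Ψ)
    (hW : IsSpectralFactor W Φ) :
    distL2 V W ^ 2 = ∫ θ, ((W θ - (pencil G Λ θ)⁻¹ * V θ)ᴴ * pencil G Λ θ *
      (W θ - (pencil G Λ θ)⁻¹ * V θ)).trace.re ∂circleMeasure + hellingerValue G Ψ Λ S := by
  have bQ := BddMeas.of_continuous (continuous_pencil hG Λ)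
  have bD := BddMeas.of_continuous (continuous_sandwich hG Λ)
  have bQi := BddMeas.of_continuous (continuous_inv_pencil hG hη hΛ)
  have bV := hV.bddMeas_of_isSpectralDensity hΨ
  have bW := hW.bddMeas_of_isSpectralDensity hΦ
  have bE := bW.sub (bQi.mul bV)
  have i1 := ((bE.conjTranspose.mul bQ).mul bE).integrable_re_trace
  have i2 := hΨ.bddMeas.integrable_re_trace
  have i3 := (bQi.mul hΨ.bddMeas).integrable_re_trace
  have i4 := (bD.mul hΦ.bddMeas).integrable_re_trace
  have i23 : Integrable (fun θ => (Ψ θ).trace.re - ((pencil G Λ θ)⁻¹ * Ψ θ).trace.re)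
    circleMeasure := i2.sub i3
  have i234 : Integrable (fun θ => (Ψ θ).trace.re - ((pencil G Λ θ)⁻¹ * Ψ θ).trace.re -
    (sandwich G Λ θ * Φ θ).trace.re) circleMeasure := i23.sub i4
  have e : (Λ * S).trace.re = ∫ θ, (sandwich G Λ θ * Φ θ).trace.re ∂circleMeasure := by
    rw [← hΦS, re_trace_mul_gram (BddMeas.of_continuous hG) hΦ.bddMeas]
    rfl
  rw [distL2_sq, hellingerValue, e, ← integral_sub i23 i4, ← integral_add i1 i234]
  refine integral_congr_ae ?_
  filter_upwards [hV.2, hW.2] with θ h1 h2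
  rw [norm_sub_sq_eq hη (hΛ θ), h1, h2]
  congr 4
  simp [pencil]

theorem isSpectralFactor_candidate (hG : Continuous G) (hΨ : IsSpectralDensity Ψ)
    {Λ : Matrix (Fin n) (Fin n) ℂ} {η : ℝ} (hη : 0 < η)
    (hΛ : ∀ θ, LowerBound η (pencil G Λ θ)) {V : Torus → Matrix (Fin m) (Fin m) ℂ}
    (hV : IsSpectralFactor V Ψ) :
    IsSpectralFactor (fun θ => (pencil G Λ θ)⁻¹ * V θ) (candidate G Ψ Λ) := by
  have b := (BddMeas.of_continuous (continuous_inv_pencil hG hη hΛ)).mul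
    (hV.bddMeas_of_isSpectralDensity hΨ)
  refine ⟨fun i j => ?_, ?_⟩
  · obtain ⟨hm, C, hC⟩ := b
    exact MemLp.of_bound (hm i j) C (hC.mono fun θ h => (norm_entry_le_norm _ i j).trans h)
  · filter_upwards [hV.2] with θ h
    have hHi : ((pencil G Λ θ)⁻¹)ᴴ = (pencil G Λ θ)⁻¹ := ((hΛ θ).posDef hη).inv.isHermitian
    rw [candidate, Matrix.conjTranspose_mul, hHi, ← h]
    simp only [mul_assoc]

/-- For the pair `V`, `Q⁻¹V` the square in `distL2_sq_eq` vanishes, so the value is itself a squared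
distance. -/
theorem hellingerValue_nonneg_and_le (hG : Continuous G) (hΨ : IsSpectralDensity Ψ)
    {Λ S : Matrix (Fin n) (Fin n) ℂ} {η : ℝ} (hη : 0 < η)
    (hΛ : ∀ θ, LowerBound η (pencil G Λ θ)) (hS : gram G (candidate G Ψ Λ) = S) :
    0 ≤ hellingerValue G Ψ Λ S ∧
      hellingerDist (candidate G Ψ Λ) Ψ ≤ √(hellingerValue G Ψ Λ S) := by
  obtain ⟨V, hV⟩ := hΨ.exists_isSpectralFactor
  have hW := isSpectralFactor_candidate hG hΨ hη hΛ hV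
  have h := distL2_sq_eq hG hΨ hη hΛ (isSpectralDensity_candidate hG hΨ hη hΛ) hS hV hW
  simp only [sub_self, Matrix.mul_zero, Matrix.trace_zero, Complex.zero_re, integral_zero,
    zero_add] at h
  refine ⟨h ▸ sq_nonneg _, csInf_le ⟨0, ?_⟩ ⟨V, _, hV, hW, ?_⟩⟩
  · rintro _ ⟨V, W, -, -, rfl⟩
    exact Real.sqrt_nonneg _
  · rw [← h]
    exact Real.sqrt_sq (Real.sqrt_nonneg _)

theorem sqrt_hellingerValue_le (hG : Continuous G) (hΨ : IsSpectralDensity Ψ)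
    {Λ S : Matrix (Fin n) (Fin n) ℂ} {η : ℝ} (hη : 0 < η)
    (hΛ : ∀ θ, LowerBound η (pencil G Λ θ)) {Φ : Torus → Matrix (Fin m) (Fin m) ℂ}
    (hΦ : IsSpectralDensity Φ) (hΦS : gram G Φ = S) :
    √(hellingerValue G Ψ Λ S) ≤ hellingerDist Φ Ψ := by
  obtain ⟨V, hV⟩ := hΨ.exists_isSpectralFactor
  obtain ⟨W, hW⟩ := hΦ.exists_isSpectralFactor
  refine le_csInf ⟨_, V, W, hV, hW, rfl⟩ ?_
  rintro _ ⟨V, W, hV, hW, rfl⟩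
  refine Real.sqrt_le_iff.2 ⟨Real.sqrt_nonneg _, ?_⟩
  rw [distL2_sq_eq hG hΨ hη hΛ hΦ hΦS hV hW]
  have : 0 ≤ ∫ θ, ((W θ - (pencil G Λ θ)⁻¹ * V θ)ᴴ * pencil G Λ θ *
      (W θ - (pencil G Λ θ)⁻¹ * V θ)).trace.re ∂circleMeasure := by
    refine integral_nonneg fun θ => ?_
    have := (((hΛ θ).posDef hη).posSemidef.conjTranspose_mul_mul_same
      (W θ - (pencil G Λ θ)⁻¹ * V θ)).trace_nonneg
    exact (Complex.le_def.1 this).1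
  linarith

/-- A feasible spectral density which attains the optimal value is the candidate. -/
theorem ae_eq_candidate (hG : Continuous G) (hΨ : IsSpectralDensity Ψ)
    {Λ S : Matrix (Fin n) (Fin n) ℂ} {η : ℝ} (hη : 0 < η)
    (hΛ : ∀ θ, LowerBound η (pencil G Λ θ)) (hval : 0 ≤ hellingerValue G Ψ Λ S)
    {Φ : Torus → Matrix (Fin m) (Fin m) ℂ}
    (hΦ : IsSpectralDensity Φ) (hΦS : gram G Φ = S)
    (hle : hellingerDist Φ Ψ ≤ √(hellingerValue G Ψ Λ S)) :
    Φ =ᵐ[circleMeasure] candidate G Ψ Λ := by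
  have hc := isSpectralDensity_candidate hG hΨ hη hΛ
  obtain ⟨C₁, hC₁⟩ := hΦ.bddMeas.2
  obtain ⟨C₂, hC₂⟩ := hc.bddMeas.2
  set C := √(m * C₁) + √(m * C₂) with hC
  have hC0 : 0 ≤ C := by positivity
  set I := ∫ θ, ‖Φ θ - candidate G Ψ Λ θ‖ ^ 2 ∂circleMeasure with hI
  have hI0 : 0 ≤ I := integral_nonneg fun θ => by positivity
  have bQ := BddMeas.of_continuous (continuous_pencil hG Λ)
  have bQi := BddMeas.of_continuous (continuous_inv_pencil hG hη hΛ)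
  -- The infimum over factors is not assumed attained, so an almost optimal pair is used. Its excess
  -- `ε` controls `η ∫ ‖W - U‖²`, and `‖WW* - UU*‖ ≤ C‖W - U‖` with `C` independent of the pair.
  have key : ∀ ε : ℝ, 0 < ε → η * I ≤ C ^ 2 * ε := by
    intro ε hε
    have hne : {r : ℝ | ∃ V W : Torus → Matrix (Fin m) (Fin m) ℂ,
        IsSpectralFactor V Ψ ∧ IsSpectralFactor W Φ ∧ r = distL2 V W}.Nonempty := by
      obtain ⟨V, hV⟩ := hΨ.exists_isSpectralFactor
      obtain ⟨W, hW⟩ := hΦ.exists_isSpectralFactor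
      exact ⟨_, V, W, hV, hW, rfl⟩
    have hlt : hellingerDist Φ Ψ < √(hellingerValue G Ψ Λ S + ε) :=
      hle.trans_lt (Real.sqrt_lt_sqrt hval (by linarith))
    obtain ⟨_, ⟨V, W, hV, hW, rfl⟩, hr⟩ := exists_lt_of_csInf_lt hne hlt
    have hr2 : distL2 V W ^ 2 < hellingerValue G Ψ Λ S + ε :=
      (Real.lt_sqrt (Real.sqrt_nonneg _)).1 hr
    rw [distL2_sq_eq hG hΨ hη hΛ hΦ hΦS hV hW] at hr2
    have bV := hV.bddMeas_of_isSpectralDensity hΨ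
    have bW := hW.bddMeas_of_isSpectralDensity hΦ
    have hU := isSpectralFactor_candidate hG hΨ hη hΛ hV
    set U : Torus → Matrix (Fin m) (Fin m) ℂ := fun θ => (pencil G Λ θ)⁻¹ * V θ with hUdef
    have bE := bW.sub (bQi.mul bV)
    have h1 : η * ∫ θ, ‖W θ - U θ‖ ^ 2 ∂circleMeasure ≤ ε := by
      refine le_trans ?_ (by linarith : ∫ θ, ((W θ - (pencil G Λ θ)⁻¹ * V θ)ᴴ * pencil G Λ θ *
        (W θ - (pencil G Λ θ)⁻¹ * V θ)).trace.re ∂circleMeasure ≤ ε)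
      rw [← integral_const_mul]
      exact integral_mono (bE.integrable_norm_sq.const_mul η)
        ((bE.conjTranspose.mul bQ).mul bE).integrable_re_trace fun θ => (hΛ θ).norm_sq_le _
    have h2 : I ≤ C ^ 2 * ∫ θ, ‖W θ - U θ‖ ^ 2 ∂circleMeasure := by
      rw [hI, ← integral_const_mul]
      refine integral_mono_ae (hΦ.bddMeas.sub hc.bddMeas).integrable_norm_sq
        (bE.integrable_norm_sq.const_mul _) ?_
      filter_upwards [hW.2, hU.2, (hW.bddMeas hC₁).2, (hU.bddMeas hC₂).2] with θ e1 e2 e3 e4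
      rw [← e1, ← e2, ← mul_pow]
      refine pow_le_pow_left₀ (norm_nonneg _) ?_ 2
      have e5 : W θ * (W θ)ᴴ - U θ * (U θ)ᴴ = W θ * (W θ - U θ)ᴴ + (W θ - U θ) * (U θ)ᴴ := by
        rw [Matrix.conjTranspose_sub, mul_sub, sub_mul]; abel
      rw [e5]
      calc _ ≤ ‖W θ‖ * ‖(W θ - U θ)ᴴ‖ + ‖W θ - U θ‖ * ‖(U θ)ᴴ‖ :=
            (norm_add_le _ _).trans (add_le_add (norm_mul_le _ _) (norm_mul_le _ _))
        _ = (‖W θ‖ + ‖U θ‖) * ‖W θ - U θ‖ := by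
            rw [Matrix.frobenius_norm_conjTranspose, Matrix.frobenius_norm_conjTranspose]; ring
        _ ≤ C * ‖W θ - U θ‖ := by rw [hC]; gcongr
    calc η * I ≤ η * (C ^ 2 * ∫ θ, ‖W θ - U θ‖ ^ 2 ∂circleMeasure) := by gcongr
      _ = C ^ 2 * (η * ∫ θ, ‖W θ - U θ‖ ^ 2 ∂circleMeasure) := by ring
      _ ≤ C ^ 2 * ε := by gcongr
  have hIz : I = 0 := by
    refine le_antisymm ?_ hI0
    by_contra! hpos
    have := key (η * I / (2 * (C ^ 2 + 1))) (by positivity)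
    have h3 : C ^ 2 * (η * I / (2 * (C ^ 2 + 1))) ≤ η * I / 2 := by
      rw [mul_div_assoc', div_le_div_iff₀ (by positivity) (by positivity)]
      nlinarith [mul_pos hη hpos]
    nlinarith [mul_pos hη hpos]
  have hz := (integral_eq_zero_iff_of_nonneg (fun θ => by positivity)
    (hΦ.bddMeas.sub hc.bddMeas).integrable_norm_sq).1 hIz
  filter_upwards [hz] with θ h
  have : ‖Φ θ - candidate G Ψ Λ θ‖ ^ 2 = 0 := h
  exact sub_eq_zero.1 (norm_eq_zero.1 (pow_eq_zero_iff two_ne_zero |>.1 this))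

theorem isHellingerSolution_candidate {A : Matrix (Fin n) (Fin n) ℂ}
    {B : Matrix (Fin n) (Fin m) ℂ} (hG : Continuous (circleTransfer A B))
    (hΨ : IsSpectralDensity Ψ) {Λ S : Matrix (Fin n) (Fin n) ℂ} {η : ℝ} (hη : 0 < η)
    (hΛ : ∀ θ, LowerBound η (pencil (circleTransfer A B) Λ θ))
    (hS : gram (circleTransfer A B) (candidate (circleTransfer A B) Ψ Λ) = S) :
    IsHellingerSolution A B Ψ S (candidate (circleTransfer A B) Ψ Λ) := by
  refine ⟨⟨isSpectralDensity_candidate hG hΨ hη hΛ, hS⟩, ?_⟩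
  rintro Φ ⟨hΦ, hΦS⟩
  exact (hellingerValue_nonneg_and_le hG hΨ hη hΛ hS).2.trans
    (sqrt_hellingerValue_le hG hΨ hη hΛ hΦ hΦS)

theorem IsHellingerSolution.ae_eq_candidate {A : Matrix (Fin n) (Fin n) ℂ}
    {B : Matrix (Fin n) (Fin m) ℂ} (hG : Continuous (circleTransfer A B))
    (hΨ : IsSpectralDensity Ψ) {Λ S : Matrix (Fin n) (Fin n) ℂ} {η : ℝ} (hη : 0 < η)
    (hΛ : ∀ θ, LowerBound η (pencil (circleTransfer A B) Λ θ))
    (hS : gram (circleTransfer A B) (candidate (circleTransfer A B) Ψ Λ) = S)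
    {Φ : Torus → Matrix (Fin m) (Fin m) ℂ} (hΦ : IsHellingerSolution A B Ψ S Φ) :
    Φ =ᵐ[circleMeasure] candidate (circleTransfer A B) Ψ Λ := by
  have h := hellingerValue_nonneg_and_le hG hΨ hη hΛ hS
  exact SpectrumApprox.ae_eq_candidate hG hΨ hη hΛ h.1 hΦ.1.1 hΦ.1.2
    ((hΦ.2 (isHellingerSolution_candidate hG hΨ hη hΛ hS).1).trans h.2)

end Hellinger

/-! ### Continuity and Lipschitz bounds for the transfer function -/

section Transfer
open scoped Matrix.Norms.Frobenius

variable {k l m n : ℕ} {A : Matrix (Fin n) (Fin n) ℂ} {B : Matrix (Fin n) (Fin m) ℂ}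

theorem IsStabilityMatrix.isUnit_det_smul_sub (hA : IsStabilityMatrix A) {z : ℂ} (hz : 1 ≤ ‖z‖) :
    IsUnit (z • (1 : Matrix (Fin n) (Fin n) ℂ) - A).det := by
  rw [← Matrix.isUnit_iff_isUnit_det]
  by_contra h
  refine (hA z ?_).not_ge hz
  rwa [spectrum.mem_iff, Algebra.algebraMap_eq_smul_one]

theorem IsStabilityMatrix.isUnit_det_one_sub_smul (hA : IsStabilityMatrix A) {w : ℂ}
    (hw : ‖w‖ ≤ 1) : IsUnit ((1 : Matrix (Fin n) (Fin n) ℂ) - w • A).det := by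
  rcases eq_or_ne w 0 with rfl | h0
  · simp
  · have h1 : (1 : Matrix (Fin n) (Fin n) ℂ) - w • A = w • (w⁻¹ • 1 - A) := by
      rw [smul_sub, smul_smul, mul_inv_cancel₀ h0, one_smul]
    rw [h1, Matrix.det_smul]
    refine IsUnit.mul ((isUnit_iff_ne_zero.2 h0).pow _) (hA.isUnit_det_smul_sub ?_)
    rw [norm_inv]
    exact (one_le_inv₀ (norm_pos_iff.2 h0)).2 hw

theorem norm_toCircle (θ : Torus) : ‖(AddCircle.toCircle θ : ℂ)‖ = 1 := Circle.norm_coe _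

theorem smul_one_sub_mul_circleTransfer (hA : IsStabilityMatrix A) (θ : Torus) :
    ((AddCircle.toCircle θ : ℂ) • (1 : Matrix (Fin n) (Fin n) ℂ) - A) * circleTransfer A B θ = B :=
  Matrix.mul_nonsing_inv_cancel_left _ _ (hA.isUnit_det_smul_sub (norm_toCircle θ).ge)

theorem mul_circleTransfer (hA : IsStabilityMatrix A) (θ : Torus) :
    A * circleTransfer A B θ = (AddCircle.toCircle θ : ℂ) • circleTransfer A B θ - B := by
  have h := smul_one_sub_mul_circleTransfer (B := B) hA θ
  rw [Matrix.sub_mul, Matrix.smul_mul, Matrix.one_mul] at h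
  rw [eq_sub_iff_add_eq, ← eq_sub_iff_add_eq']
  exact h.symm

theorem continuous_toCircle_coe : Continuous fun θ : Torus => (AddCircle.toCircle θ : ℂ) :=
  continuous_subtype_val.comp AddCircle.continuous_toCircle

theorem continuous_resolvent (hA : IsStabilityMatrix A) : Continuous fun θ : Torus =>
    ((AddCircle.toCircle θ : ℂ) • (1 : Matrix (Fin n) (Fin n) ℂ) - A)⁻¹ :=
  continuous_matrix_inv ((continuous_toCircle_coe.smul continuous_const).sub continuous_const)
    fun θ => hA.isUnit_det_smul_sub (norm_toCircle θ).ge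

theorem continuous_circleTransfer (hA : IsStabilityMatrix A) : Continuous (circleTransfer A B) :=
  (continuous_resolvent hA).matrix_mul continuous_const

theorem norm_toCircle_add_sub_le (θ : Torus) (t : ℝ) :
    ‖(AddCircle.toCircle (θ + (t : Torus)) : ℂ) - AddCircle.toCircle θ‖ ≤ |t| := by
  have h1 : (AddCircle.toCircle (t : Torus) : ℂ) = Complex.exp (Complex.I * t) := by
    rw [AddCircle.toCircle_apply_mk, div_self Real.two_pi_pos.ne', one_mul, Circle.coe_exp,
      mul_comm]
  rw [AddCircle.toCircle_add, Circle.coe_mul, ← mul_sub_one, norm_mul, norm_toCircle, one_mul, h1]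
  exact Real.norm_exp_I_mul_ofReal_sub_one_le

/-- The resolvent identity, with the resolvent bounded on the circle and `|e^{it} - 1| ≤ |t|`. -/
theorem exists_lipschitz_circleTransfer (hA : IsStabilityMatrix A)
    (B : Matrix (Fin n) (Fin m) ℂ) :
    ∃ L : ℝ, 0 ≤ L ∧ ∀ (θ : Torus) (t : ℝ),
      ‖circleTransfer A B (θ + t) - circleTransfer A B θ‖ ≤ L * |t| := by
  obtain ⟨r, hr, hrA⟩ := exists_norm_le_of_continuous (continuous_resolvent hA)
  refine ⟨r * r * ‖B‖, by positivity, fun θ t => ?_⟩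
  have h1 := inv_sub_inv_eq (hA.isUnit_det_smul_sub (norm_toCircle θ).ge)
    (hA.isUnit_det_smul_sub (norm_toCircle (θ + (t : Torus))).ge)
  set z : ℂ := (AddCircle.toCircle θ : ℂ) with hz
  set w : ℂ := (AddCircle.toCircle (θ + (t : Torus)) : ℂ) with hw
  have h2 : circleTransfer A B (θ + t) - circleTransfer A B θ =
      (z - w) • ((w • (1 : Matrix (Fin n) (Fin n) ℂ) - A)⁻¹ *
        (z • (1 : Matrix (Fin n) (Fin n) ℂ) - A)⁻¹ * B) := by
    have h3 : w • (1 : Matrix (Fin n) (Fin n) ℂ) - A - (z • 1 - A) = (w - z) • 1 := by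
      rw [sub_smul]; abel
    rw [h3, Matrix.mul_smul, Matrix.smul_mul, mul_one, ← neg_smul, neg_sub] at h1
    change _ * B - _ * B = _
    rw [← Matrix.sub_mul, h1, Matrix.smul_mul]
  have h4 : ‖z - w‖ ≤ |t| := by
    rw [norm_sub_rev]
    exact norm_toCircle_add_sub_le θ t
  have h5 : ‖(w • (1 : Matrix (Fin n) (Fin n) ℂ) - A)⁻¹ *
        (z • (1 : Matrix (Fin n) (Fin n) ℂ) - A)⁻¹ * B‖ ≤ r * r * ‖B‖ := by
    refine (Matrix.frobenius_norm_mul _ _).trans ?_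
    gcongr
    refine (Matrix.frobenius_norm_mul _ _).trans ?_
    exact mul_le_mul (hrA _) (hrA _) (norm_nonneg _) hr.le
  rw [h2, norm_smul, mul_comm]
  gcongr

end Transfer

/-! ### Linearity of the entrywise integral -/

section MatrixIntegral

variable {j k l m n : ℕ}

/-- The entrywise integral of a matrix-valued function on the circle. -/
def matIntegral (f : Torus → Matrix (Fin k) (Fin l) ℂ) : Matrix (Fin k) (Fin l) ℂ :=
  Matrix.of fun i j => ∫ θ, f θ i j ∂circleMeasure

theorem matIntegral_congr {f g : Torus → Matrix (Fin k) (Fin l) ℂ} (h : ∀ θ, f θ = g θ) :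
    matIntegral f = matIntegral g := by
  rw [funext h]

theorem matIntegral_const (M : Matrix (Fin k) (Fin l) ℂ) : matIntegral (fun _ => M) = M := by
  ext i j
  simp [matIntegral]

theorem matIntegral_add {f g : Torus → Matrix (Fin k) (Fin l) ℂ} (hf : BddMeas f)
    (hg : BddMeas g) : matIntegral (fun θ => f θ + g θ) = matIntegral f + matIntegral g := by
  ext i j
  exact integral_add (hf.integrable_entry i j) (hg.integrable_entry i j)

theorem matIntegral_sub {f g : Torus → Matrix (Fin k) (Fin l) ℂ} (hf : BddMeas f)
    (hg : BddMeas g) : matIntegral (fun θ => f θ - g θ) = matIntegral f - matIntegral g := by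
  ext i j
  exact integral_sub (hf.integrable_entry i j) (hg.integrable_entry i j)

theorem matIntegral_const_mul {f : Torus → Matrix (Fin k) (Fin l) ℂ} (hf : BddMeas f)
    (M : Matrix (Fin j) (Fin k) ℂ) : matIntegral (fun θ => M * f θ) = M * matIntegral f := by
  ext i p
  simp only [matIntegral, Matrix.of_apply, Matrix.mul_apply]
  refine (integral_finsetSum _ fun q _ => (hf.integrable_entry q p).const_mul _).trans ?_
  exact Finset.sum_congr rfl fun q _ => integral_const_mul _ _

theorem matIntegral_mul_const {f : Torus → Matrix (Fin k) (Fin l) ℂ} (hf : BddMeas f)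
    (M : Matrix (Fin l) (Fin j) ℂ) : matIntegral (fun θ => f θ * M) = matIntegral f * M := by
  ext i p
  simp only [matIntegral, Matrix.of_apply, Matrix.mul_apply]
  refine (integral_finsetSum _ fun q _ => (hf.integrable_entry i q).mul_const _).trans ?_
  exact Finset.sum_congr rfl fun q _ => integral_mul_const _ _

theorem matIntegral_conjTranspose (f : Torus → Matrix (Fin k) (Fin l) ℂ) :
    matIntegral (fun θ => (f θ)ᴴ) = (matIntegral f)ᴴ := by
  ext i j
  exact integral_conj

end MatrixIntegral

/-! ### The Stein equation for moments -/

section Stein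

variable {m n : ℕ} {A : Matrix (Fin n) (Fin n) ℂ} {B : Matrix (Fin n) (Fin m) ℂ}

/-- Elements of the range of `Γ` satisfy a Stein equation. -/
theorem exists_stein_of_mem_rangeGamma (hA : IsStabilityMatrix A) {S : Matrix (Fin n) (Fin n) ℂ}
    (hS : S ∈ rangeGamma A B) :
    ∃ H : Matrix (Fin m) (Fin n) ℂ, S - A * S * Aᴴ = B * H + Hᴴ * Bᴴ := by
  obtain ⟨Φ, hΦ, rfl⟩ := hS
  have bG := BddMeas.of_continuous (continuous_circleTransfer (B := B) hA)
  have bΦ := BddMeas.of_continuous Φ.continuous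
  have bF := (bG.mul bΦ).mul bG.conjTranspose
  -- Since `AG = zG - B`, `GΦG* - AGΦG*A* = zGΦB* + z̄BΦG* - BΦB*`; the last term is split evenly
  -- between `Bh` and `h*B*`, whence the `1/2`.
  set h : Torus → Matrix (Fin m) (Fin n) ℂ := fun θ =>
    star (AddCircle.toCircle θ : ℂ) • (Φ θ * (circleTransfer A B θ)ᴴ) - (1 / 2 : ℂ) • (Φ θ * Bᴴ)
  have bh : BddMeas h := by
    refine BddMeas.of_continuous ?_
    have hG := continuous_circleTransfer (B := B) hA
    have h1 : Continuous fun θ => Φ θ * Bᴴ := Φ.continuous.matrix_mul continuous_const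
    have h2 : Continuous fun θ => (1 / 2 : ℂ) • (Φ θ * Bᴴ) := by
      fun_prop
    exact ((continuous_star.comp continuous_toCircle_coe).smul
      (Φ.continuous.matrix_mul hG.matrix_conjTranspose)).sub h2
  have hm : moment A B Φ = matIntegral fun θ =>
    circleTransfer A B θ * Φ θ * (circleTransfer A B θ)ᴴ := rfl
  refine ⟨matIntegral h, ?_⟩
  rw [hm, ← matIntegral_conjTranspose, ← matIntegral_const_mul bF,
    ← matIntegral_mul_const ((BddMeas.const A).mul bF),
    ← matIntegral_sub bF (((BddMeas.const A).mul bF).mul (BddMeas.const Aᴴ)),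
    ← matIntegral_const_mul bh, ← matIntegral_mul_const bh.conjTranspose,
    ← matIntegral_add ((BddMeas.const B).mul bh) (bh.conjTranspose.mul (BddMeas.const Bᴴ))]
  refine matIntegral_congr fun θ => ?_
  have e1 := mul_circleTransfer (B := B) hA θ
  have hz : star (AddCircle.toCircle θ : ℂ) * (AddCircle.toCircle θ : ℂ) = 1 := by
    have := Complex.conj_mul' (AddCircle.toCircle θ : ℂ)
    rw [norm_toCircle] at this
    simpa using this
  have hP : (Φ θ)ᴴ = Φ θ := hΦ θ
  have e2 : A * (circleTransfer A B θ * Φ θ * (circleTransfer A B θ)ᴴ) * Aᴴ =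
      (A * circleTransfer A B θ) * Φ θ * (A * circleTransfer A B θ)ᴴ := by
    rw [Matrix.conjTranspose_mul]
    simp only [Matrix.mul_assoc]
  rw [e2, e1]
  simp only [h]
  set z := (AddCircle.toCircle θ : ℂ)
  set G := circleTransfer A B θ
  simp only [Matrix.conjTranspose_sub, Matrix.conjTranspose_smul, Matrix.conjTranspose_mul,
    Matrix.conjTranspose_conjTranspose, hP, star_star, Matrix.sub_mul, Matrix.mul_sub,
    Matrix.smul_mul, Matrix.mul_smul, Matrix.mul_assoc]
  have h2 : star (1 / 2 : ℂ) = 1 / 2 := by simp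
  rw [h2]
  match_scalars <;> first | ring1 | linear_combination -hz

theorem mulVec_injective_of_rank_eq (hB : B.rank = m) : Function.Injective B.mulVec := by
  have h := LinearMap.finrank_range_add_finrank_ker B.mulVecLin
  rw [Matrix.rank] at hB
  rw [hB, Module.finrank_fin_fun] at h
  have : LinearMap.ker B.mulVecLin = ⊥ := Submodule.finrank_eq_zero.1 (by omega)
  exact LinearMap.ker_eq_bot.1 this

end Stein

/-! ### Mean value property for the resolvent -/

section MeanValue

variable {n : ℕ}

theorem integral_toCircle (f : ℂ → ℂ) :
    ∫ θ : Torus, f (AddCircle.toCircle θ : ℂ) ∂circleMeasure = Real.circleAverage f 0 1 := by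
  rw [AddCircle.integral_haarAddCircle, Real.circleAverage,
    ← AddCircle.intervalIntegral_preimage (2 * π) 0]
  simp [AddCircle.toCircle_apply_mk, circleMap]

theorem differentiableAt_inv_entry {Z : Matrix (Fin n) (Fin n) ℂ} {w : ℂ}
    (hw : IsUnit ((1 : Matrix (Fin n) (Fin n) ℂ) - w • Z).det) (i j : Fin n) :
    DifferentiableAt ℂ (fun w : ℂ => ((1 : Matrix (Fin n) (Fin n) ℂ) - w • Z)⁻¹ i j) w := by
  have he : ∀ p q : Fin n,
      Differentiable ℂ fun w : ℂ => ((1 : Matrix (Fin n) (Fin n) ℂ) - w • Z) p q := by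
    intro p q
    simp only [Matrix.sub_apply, Matrix.smul_apply, smul_eq_mul]
    fun_prop
  have hdet : Differentiable ℂ fun w : ℂ => ((1 : Matrix (Fin n) (Fin n) ℂ) - w • Z).det := by
    simp only [Matrix.det_apply]
    refine Differentiable.fun_sum fun σ _ => ?_
    refine Differentiable.fun_const_smul (Differentiable.fun_finsetProd fun p _ => he _ _) _
  have hadj : Differentiable ℂ fun w : ℂ =>
      ((1 : Matrix (Fin n) (Fin n) ℂ) - w • Z).adjugate i j := by
    simp only [Matrix.adjugate_apply, Matrix.det_apply]
    refine Differentiable.fun_sum fun σ _ => ?_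
    refine Differentiable.fun_const_smul (Differentiable.fun_finsetProd fun p _ => ?_) _
    simp only [Matrix.updateRow_apply]
    split_ifs
    · exact differentiable_const _
    · exact he _ _
  have : (fun w : ℂ => ((1 : Matrix (Fin n) (Fin n) ℂ) - w • Z)⁻¹ i j) = fun w : ℂ =>
      (((1 : Matrix (Fin n) (Fin n) ℂ) - w • Z).det)⁻¹ *
        ((1 : Matrix (Fin n) (Fin n) ℂ) - w • Z).adjugate i j := by
    ext w
    rw [Matrix.inv_def, Ring.inverse_eq_inv', Matrix.smul_apply, smul_eq_mul]
  rw [this]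
  exact ((hdet w).inv hw.ne_zero).mul (hadj w)

/-- The mean over the circle of `(I - z̄ Z)⁻¹`. -/
theorem matIntegral_inv_one_sub_smul {Z : Matrix (Fin n) (Fin n) ℂ}
    (hZ : ∀ w : ℂ, ‖w‖ ≤ 1 → IsUnit ((1 : Matrix (Fin n) (Fin n) ℂ) - w • Z).det) :
    matIntegral (fun θ => ((1 : Matrix (Fin n) (Fin n) ℂ) -
      (AddCircle.toCircle θ : ℂ)⁻¹ • Z)⁻¹) = 1 := by
  ext i j
  set f : ℂ → ℂ := fun w => ((1 : Matrix (Fin n) (Fin n) ℂ) - w • Z)⁻¹ i j with hf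
  have hd : ∀ w : ℂ, ‖w‖ ≤ 1 → DifferentiableAt ℂ f w := fun w hw =>
    differentiableAt_inv_entry (hZ w hw) i j
  -- The reflection `θ ↦ -θ` replaces `z⁻¹` by `z`, making the integrand analytic in the disc with
  -- value `1` (as a matrix) at the centre.
  have h1 : ∫ θ : Torus, f (AddCircle.toCircle θ : ℂ)⁻¹ ∂circleMeasure =
      ∫ θ : Torus, f (AddCircle.toCircle θ : ℂ) ∂circleMeasure := by
    rw [← integral_neg_eq_self]
    congr with θ
    rw [AddCircle.toCircle_neg, Circle.coe_inv, inv_inv]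
  have h2 : Real.circleAverage f 0 1 = f 0 := by
    refine circleAverage_of_differentiable_on_off_countable Set.countable_empty ?_ ?_
    · intro w hw
      exact (hd w (by simpa using hw)).continuousAt.continuousWithinAt
    · intro w hw
      exact hd w (by simpa using (Metric.ball_subset_closedBall hw.1))
  change ∫ θ : Torus, f (AddCircle.toCircle θ : ℂ)⁻¹ ∂circleMeasure = _
  rw [h1, integral_toCircle, h2, hf]
  simp

end MeanValue

/-! ### The maximum entropy density -/

section MaximumEntropy
open scoped Matrix.Norms.Frobenius

variable {m n : ℕ} {A : Matrix (Fin n) (Fin n) ℂ} {B : Matrix (Fin n) (Fin m) ℂ}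

/-- A Lyapunov argument. If `x` is in the kernel of `(1 - wZ)*` and `y = Z*x`, then `|w|² y*Sy =
x*Sx = y*Sy + (B*x)*P(B*x)`, so `|w| ≤ 1` forces `B*x = 0`. Then `Z*x = A*x`, and `x` contradicts
the stability of `A`. -/
theorem isUnit_det_one_sub_smul_of_stein (hA : IsStabilityMatrix A) {S : Matrix (Fin n) (Fin n) ℂ}
    (hS : S.PosDef) {P : Matrix (Fin m) (Fin m) ℂ} (hP : P.PosDef)
    {K : Matrix (Fin m) (Fin n) ℂ} {Z : Matrix (Fin n) (Fin n) ℂ} (hZ : Z = A - B * (K * A))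
    (hSZ : S - Z * S * Zᴴ = B * P * Bᴴ) {w : ℂ} (hw : ‖w‖ ≤ 1) :
    IsUnit ((1 : Matrix (Fin n) (Fin n) ℂ) - w • Z).det := by
  rw [isUnit_iff_ne_zero]
  intro hdet
  have hdet' : ((1 : Matrix (Fin n) (Fin n) ℂ) - w • Z)ᴴ.det = 0 := by
    rw [Matrix.det_conjTranspose, hdet, star_zero]
  obtain ⟨x, hx, hxZ⟩ := Matrix.exists_mulVec_eq_zero_iff.2 hdet'
  rw [Matrix.conjTranspose_sub, Matrix.conjTranspose_one, Matrix.conjTranspose_smul,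
    Matrix.sub_mulVec, Matrix.one_mulVec, Matrix.smul_mulVec, sub_eq_zero] at hxZ
  have hq : ∀ (k : ℕ) (M : Matrix (Fin n) (Fin k) ℂ) (T : Matrix (Fin k) (Fin k) ℂ),
      star x ⬝ᵥ ((M * T * Mᴴ) *ᵥ x) = star (Mᴴ *ᵥ x) ⬝ᵥ (T *ᵥ (Mᴴ *ᵥ x)) := by
    intro k M T
    rw [Matrix.mul_assoc, ← Matrix.mulVec_mulVec, Matrix.dotProduct_mulVec, Matrix.star_mulVec,
      Matrix.conjTranspose_conjTranspose, Matrix.mulVec_mulVec]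
  set y := Zᴴ *ᵥ x with hy
  have h1 : star x ⬝ᵥ (S *ᵥ x) = star y ⬝ᵥ (S *ᵥ y) + star (Bᴴ *ᵥ x) ⬝ᵥ (P *ᵥ (Bᴴ *ᵥ x)) := by
    rw [← hq, ← hq, ← dotProduct_add, ← Matrix.add_mulVec, ← hSZ]
    congr 2
    abel
  have h2 : star x ⬝ᵥ (S *ᵥ x) = ((‖w‖ ^ 2 : ℝ) : ℂ) * (star y ⬝ᵥ (S *ᵥ y)) := by
    conv_lhs => rw [hxZ]
    rw [star_smul, star_star, Matrix.mulVec_smul, smul_dotProduct, dotProduct_smul, smul_smul,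
      smul_eq_mul]
    congr 1
    have := Complex.mul_conj' w
    push_cast
    exact this
  have h3 : 0 ≤ (star y ⬝ᵥ (S *ᵥ y)).re := hS.posSemidef.re_dotProduct_nonneg y
  have h4 : (Bᴴ *ᵥ x) = 0 := by
    by_contra hne
    have h5 : 0 < (star (Bᴴ *ᵥ x) ⬝ᵥ (P *ᵥ (Bᴴ *ᵥ x))).re := hP.re_dotProduct_pos hne
    have h6 := congrArg Complex.re h1
    rw [h2, Complex.re_ofReal_mul, Complex.add_re] at h6
    have h7 : ‖w‖ ^ 2 ≤ 1 := pow_le_one₀ (norm_nonneg _) hw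
    nlinarith
  have h8 : y = Aᴴ *ᵥ x := by
    rw [hy, hZ, Matrix.conjTranspose_sub, Matrix.conjTranspose_mul B, Matrix.sub_mulVec,
      ← Matrix.mulVec_mulVec x _ Bᴴ, h4, Matrix.mulVec_zero, sub_zero]
  have h9 : ((1 : Matrix (Fin n) (Fin n) ℂ) - w • A)ᴴ *ᵥ x = 0 := by
    rw [Matrix.conjTranspose_sub, Matrix.conjTranspose_one, Matrix.conjTranspose_smul,
      Matrix.sub_mulVec, Matrix.one_mulVec, Matrix.smul_mulVec, sub_eq_zero, ← h8]
    exact hxZ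
  have h10 := Matrix.exists_mulVec_eq_zero_iff.1 ⟨x, hx, h9⟩
  rw [Matrix.det_conjTranspose, star_eq_zero] at h10
  exact (hA.isUnit_det_one_sub_smul hw).ne_zero h10

/-- Every positive definite element of the range of `Γ` is the moment of a spectral density. -/
theorem exists_isSpectralDensity_gram_eq (hA : IsStabilityMatrix A) (hB : B.rank = m)
    {S : Matrix (Fin n) (Fin n) ℂ} (hS : S ∈ posGamma A B) :
    ∃ Φ, IsSpectralDensity Φ ∧ gram (circleTransfer A B) Φ = S := by
  obtain ⟨H, hH⟩ := exists_stein_of_mem_rangeGamma hA hS.1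
  have hSd := hS.2
  have hBinj := mulVec_injective_of_rank_eq hB
  have hSH : Sᴴ = S := hSd.isHermitian
  have hSu : IsUnit S.det := (Matrix.isUnit_iff_isUnit_det _).1 hSd.isUnit
  obtain ⟨P, hPdef⟩ : ∃ P, P = Bᴴ * S⁻¹ * B := ⟨_, rfl⟩
  have hP : P.PosDef := hPdef ▸ hSd.inv.conjTranspose_mul_mul_same hBinj
  have hPu : IsUnit P.det := (Matrix.isUnit_iff_isUnit_det _).1 hP.isUnit
  have hPiH : (P⁻¹)ᴴ = P⁻¹ := hP.inv.isHermitian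
  -- `K` is the left inverse of `B` for which `T = 1 - BK` is the `S⁻¹`-orthogonal projection
  -- killing the range of `B`. Conjugating the Stein equation by `T` therefore removes the unknown
  -- `H`.
  obtain ⟨K, hK⟩ : ∃ K, K = P⁻¹ * Bᴴ * S⁻¹ := ⟨_, rfl⟩
  have hKB : K * B = 1 := by
    rw [hK, Matrix.mul_assoc, Matrix.mul_assoc, ← Matrix.mul_assoc Bᴴ, ← hPdef,
      Matrix.nonsing_inv_mul _ hPu]
  have hKS : K * S = P⁻¹ * Bᴴ := by rw [hK, Matrix.nonsing_inv_mul_cancel_right _ _ hSu]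
  have hSK : S * Kᴴ = B * P⁻¹ := by
    have := congrArg Matrix.conjTranspose hKS
    rwa [Matrix.conjTranspose_mul, Matrix.conjTranspose_mul, hSH, hPiH,
      Matrix.conjTranspose_conjTranspose] at this
  set Z := A - B * (K * A) with hZ
  set T := (1 : Matrix (Fin n) (Fin n) ℂ) - B * K with hT
  have hZT : Z = T * A := by rw [hZ, hT, Matrix.sub_mul, Matrix.one_mul, Matrix.mul_assoc]
  have hTB : T * B = 0 := by
    rw [hT, Matrix.sub_mul, Matrix.mul_assoc, hKB, Matrix.one_mul, Matrix.mul_one, sub_self]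
  have hBT : Bᴴ * Tᴴ = 0 := by
    rw [← Matrix.conjTranspose_mul, hTB, Matrix.conjTranspose_zero]
  have hTST : T * S * Tᴴ = S - B * P⁻¹ * Bᴴ := by
    have e1 : T * S = S - B * P⁻¹ * Bᴴ := by
      rw [hT, Matrix.sub_mul, Matrix.one_mul, Matrix.mul_assoc B, hKS, Matrix.mul_assoc]
    rw [e1, Matrix.sub_mul, Matrix.mul_assoc _ Bᴴ, hBT, Matrix.mul_zero, sub_zero, hT,
      Matrix.conjTranspose_sub, Matrix.conjTranspose_one, Matrix.conjTranspose_mul, Matrix.mul_sub,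
      Matrix.mul_one, ← Matrix.mul_assoc, hSK]
  have hSZ : S - Z * S * Zᴴ = B * P⁻¹ * Bᴴ := by
    have e1 : A * S * Aᴴ = S - (B * H + Hᴴ * Bᴴ) := by rw [← hH]; abel
    have e2 : Z * S * Zᴴ = T * (A * S * Aᴴ) * Tᴴ := by
      rw [hZT, Matrix.conjTranspose_mul]
      simp only [Matrix.mul_assoc]
    rw [e2, e1, Matrix.mul_sub, Matrix.sub_mul, hTST, Matrix.mul_add, Matrix.add_mul,
      ← Matrix.mul_assoc T B, hTB, Matrix.mul_assoc T, Matrix.mul_assoc Hᴴ, hBT]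
    simp
  have hZu : ∀ w : ℂ, ‖w‖ ≤ 1 → IsUnit ((1 : Matrix (Fin n) (Fin n) ℂ) - w • Z).det :=
    fun w hw => isUnit_det_one_sub_smul_of_stein hA hSd hP.inv hZ hSZ hw
  set G := circleTransfer A B with hG
  have hGc : Continuous G := continuous_circleTransfer hA
  set R : Torus → Matrix (Fin n) (Fin n) ℂ := fun θ =>
    ((1 : Matrix (Fin n) (Fin n) ℂ) - (AddCircle.toCircle θ : ℂ)⁻¹ • Z)⁻¹ with hR
  have hzn : ∀ θ : Torus, ‖(AddCircle.toCircle θ : ℂ)⁻¹‖ = 1 := fun θ => by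
    rw [norm_inv, norm_toCircle, inv_one]
  have hRu : ∀ θ : Torus,
      IsUnit ((1 : Matrix (Fin n) (Fin n) ℂ) - (AddCircle.toCircle θ : ℂ)⁻¹ • Z).det :=
    fun θ => hZu _ (hzn θ).le
  have hRc : Continuous R := by
    refine continuous_matrix_inv (continuous_const.sub (Continuous.fun_smul ?_ continuous_const)) hRu
    exact continuous_toCircle_coe.inv₀ fun θ => by simp
  set E : Torus → Matrix (Fin m) (Fin m) ℂ := fun θ => K * G θ
  have hEc : Continuous E := continuous_const.matrix_mul hGc
  -- Feedback factorization: `ZG = z(G - BE)` because `KB = 1`. Injectivity of `G(z)`, inherited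
  -- from `B`, then makes `E` invertible.
  have hGE : ∀ θ, G θ = R θ * (B * E θ) := by
    intro θ
    have hz0 : (AddCircle.toCircle θ : ℂ) ≠ 0 := by simp
    have e1 : A * G θ = (AddCircle.toCircle θ : ℂ) • G θ - B := mul_circleTransfer hA θ
    have e2 : Z * G θ = (AddCircle.toCircle θ : ℂ) • (G θ - B * E θ) := by
      rw [hZ, Matrix.sub_mul, Matrix.mul_assoc, Matrix.mul_assoc, e1, Matrix.mul_sub, hKB,
        Matrix.mul_sub, Matrix.mul_one, Matrix.mul_smul, Matrix.mul_smul, smul_sub]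
      abel
    have e3 : ((1 : Matrix (Fin n) (Fin n) ℂ) - (AddCircle.toCircle θ : ℂ)⁻¹ • Z) * G θ =
        B * E θ := by
      rw [Matrix.sub_mul, Matrix.one_mul, Matrix.smul_mul, e2, smul_smul, inv_mul_cancel₀ hz0,
        one_smul, sub_sub_cancel]
    rw [← e3]
    exact (Matrix.nonsing_inv_mul_cancel_left _ _ (hRu θ)).symm
  have hEu : ∀ θ, IsUnit (E θ).det := by
    intro θ
    rw [← Matrix.isUnit_iff_isUnit_det, ← Matrix.mulVec_injective_iff_isUnit]
    intro x y hxy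
    refine hBinj ?_
    have e1 : G θ *ᵥ x = G θ *ᵥ y := by
      rw [hGE, ← Matrix.mul_assoc, ← Matrix.mulVec_mulVec, ← Matrix.mulVec_mulVec _ (R θ * B), hxy]
    have e2 := smul_one_sub_mul_circleTransfer (B := B) hA θ
    rw [← e2, ← Matrix.mulVec_mulVec, ← Matrix.mulVec_mulVec]
    exact congrArg _ e1
  set Φ : Torus → Matrix (Fin m) (Fin m) ℂ := fun θ => (E θ)⁻¹ * P⁻¹ * ((E θ)⁻¹)ᴴ with hΦ
  have hEic : Continuous fun θ => (E θ)⁻¹ := continuous_matrix_inv hEc hEu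
  have bΦ : BddMeas Φ := BddMeas.of_continuous
    ((hEic.matrix_mul continuous_const).matrix_mul hEic.matrix_conjTranspose)
  obtain ⟨p, hp, hpP⟩ := exists_lowerBound_of_posDef hP.inv
  obtain ⟨C, hC, hCE⟩ := exists_norm_le_of_continuous
    (hEc.matrix_mul hEc.matrix_conjTranspose)
  have hlow : ∀ θ, LowerBound (p / (m * C + 1)) (Φ θ) := by
    intro θ
    refine hpP.conj hp.le (by positivity) (Matrix.nonsing_inv_mul _ (hEu θ)) ?_
    have : (m : ℝ) * ‖E θ * (E θ)ᴴ‖ ≤ m * C := by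
      have := hCE θ
      gcongr
    linarith
  refine ⟨Φ, ⟨fun i j => (bΦ.1 i j).aemeasurable, .of_forall fun θ => (hlow θ).isHermitian, ?_,
    _, ?_, .of_forall hlow⟩, ?_⟩
  · simpa only [frobenius_eq_norm] using bΦ.2
  · positivity
  have bR := BddMeas.of_continuous hRc
  -- The factors `E` cancel, leaving `RBP⁻¹B*R*`. Substituting `BP⁻¹B* = S - (wZ)S(wZ)*` and `R(wZ)
  -- = R - 1` gives `RSR* - (R - 1)S(R - 1)*`.
  have key : ∀ θ, G θ * Φ θ * (G θ)ᴴ = S * (R θ)ᴴ + R θ * S - S := by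
    intro θ
    have e1 : E θ * (E θ)⁻¹ = 1 := Matrix.mul_nonsing_inv _ (hEu θ)
    have e1' : ((E θ)⁻¹)ᴴ * (E θ)ᴴ = 1 := by
      rw [← Matrix.conjTranspose_mul, e1, Matrix.conjTranspose_one]
    have e2 : G θ * Φ θ * (G θ)ᴴ = R θ * (B * P⁻¹ * Bᴴ) * (R θ)ᴴ := by
      have : G θ * Φ θ * (G θ)ᴴ = R θ * (B * ((E θ * (E θ)⁻¹) * P⁻¹ *
          (((E θ)⁻¹)ᴴ * (E θ)ᴴ)) * Bᴴ) * (R θ)ᴴ := by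
        rw [hGE θ]
        simp only [hΦ, Matrix.conjTranspose_mul, Matrix.mul_assoc]
      rw [this, e1, e1', Matrix.one_mul, Matrix.mul_one]
    set w := (AddCircle.toCircle θ : ℂ)⁻¹ with hwdef
    have hww : w * star w = 1 := by
      have := Complex.mul_conj' w
      rw [hzn θ] at this
      simpa using this
    have e3 : R θ * (w • Z) = R θ - 1 := by
      have : R θ * (1 - w • Z) = 1 := Matrix.nonsing_inv_mul _ (hRu θ)
      rw [mul_sub, mul_one] at this
      rw [← this, sub_sub_cancel]
    have e4 : B * P⁻¹ * Bᴴ = S - (w • Z) * S * (w • Z)ᴴ := by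
      rw [← hSZ, Matrix.conjTranspose_smul, Matrix.smul_mul, Matrix.smul_mul, Matrix.mul_smul,
        smul_smul, hww, one_smul]
    have e5 : R θ * ((w • Z) * S * (w • Z)ᴴ) * (R θ)ᴴ = (R θ - 1) * S * (R θ - 1)ᴴ := by
      rw [← e3, Matrix.conjTranspose_mul]
      simp only [Matrix.mul_assoc]
    rw [e2, e4, mul_sub, sub_mul, e5, Matrix.conjTranspose_sub, Matrix.conjTranspose_one]
    noncomm_ring
  change matIntegral (fun θ => G θ * Φ θ * (G θ)ᴴ) = S
  rw [matIntegral_congr key, matIntegral_sub (((BddMeas.const S).mul bR.conjTranspose).add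
    (bR.mul (BddMeas.const S))) (BddMeas.const S), matIntegral_add ((BddMeas.const S).mul
    bR.conjTranspose) (bR.mul (BddMeas.const S)), matIntegral_const,
    matIntegral_const_mul bR.conjTranspose, matIntegral_mul_const bR, matIntegral_conjTranspose,
    matIntegral_inv_one_sub_smul hZu]
  simp

end MaximumEntropy

/-! ### Removing the kernel and assembling well-posedness -/

section WellPosedness
open scoped Matrix.Norms.Frobenius

variable {m n : ℕ} {A : Matrix (Fin n) (Fin n) ℂ} {B : Matrix (Fin n) (Fin m) ℂ}
variable {G : Torus → Matrix (Fin n) (Fin m) ℂ} {Ψ : Torus → Matrix (Fin m) (Fin m) ℂ}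

/-- The real vector space of Hermitian matrices. -/
def hermitianSubmodule (n : ℕ) : Submodule ℝ (Matrix (Fin n) (Fin n) ℂ) where
  carrier := {Λ | Λ.IsHermitian}
  add_mem' := fun h₁ h₂ => Matrix.IsHermitian.add h₁ h₂
  zero_mem' := Matrix.isHermitian_zero
  smul_mem' := fun c Λ (h : Λᴴ = Λ) => by
    change (c • Λ)ᴴ = c • Λ
    rw [Matrix.conjTranspose_smul, h, star_trivial]

/-- The Hermitian matrices `Λ` with `G* Λ G = 0`. -/
def sandwichKer (G : Torus → Matrix (Fin n) (Fin m) ℂ) :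
    Submodule ℝ (Matrix (Fin n) (Fin n) ℂ) where
  carrier := {Λ | Λ.IsHermitian ∧ ∀ θ, sandwich G Λ θ = 0}
  add_mem' := fun h₁ h₂ => ⟨Matrix.IsHermitian.add h₁.1 h₂.1, fun θ => by
    rw [sandwich_add, h₁.2, h₂.2, add_zero]⟩
  zero_mem' := ⟨Matrix.isHermitian_zero, sandwich_zero⟩
  smul_mem' := fun c Λ h => ⟨(hermitianSubmodule n).smul_mem c h.1, fun θ => by
    rw [sandwich_smul, h.2, smul_zero]⟩

/-- A complement in the space of all matrices is cut down to its Hermitian part; it still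
complements the kernel there because kernel elements are Hermitian. -/
theorem exists_complement_sandwichKer (G : Torus → Matrix (Fin n) (Fin m) ℂ) :
    ∃ V : Submodule ℝ (Matrix (Fin n) (Fin n) ℂ), (∀ Λ ∈ V, Λ.IsHermitian) ∧
      (∀ Λ ∈ V, (∀ θ, sandwich G Λ θ = 0) → Λ = 0) ∧
      ∀ Λ : Matrix (Fin n) (Fin n) ℂ, Λ.IsHermitian →
        ∃ Λ₁ ∈ V, ∃ Λ₂ ∈ sandwichKer G, Λ = Λ₁ + Λ₂ := by
  obtain ⟨W, hW⟩ := (sandwichKer G).exists_isCompl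
  refine ⟨W ⊓ hermitianSubmodule n, fun Λ h => h.2, fun Λ h h0 => ?_, fun Λ h => ?_⟩
  · exact Submodule.disjoint_def.1 hW.disjoint Λ ⟨h.2, h0⟩ h.1
  · have hΛ : Λ ∈ sandwichKer G ⊔ W := by rw [hW.sup_eq_top]; trivial
    obtain ⟨Λ₂, h₂, Λ₁, h₁, rfl⟩ := Submodule.mem_sup.1 hΛ
    refine ⟨Λ₁, ⟨h₁, ?_⟩, Λ₂, h₂, add_comm _ _⟩
    have : Λ₁ = (Λ₂ + Λ₁) - Λ₂ := by abel
    rw [this]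
    exact (hermitianSubmodule n).sub_mem h h₂.1

theorem re_trace_mul_gram_eq_zero (hG : Continuous G) {Φ : Torus → Matrix (Fin m) (Fin m) ℂ}
    (hΦ : BddMeas Φ) {Λ : Matrix (Fin n) (Fin n) ℂ} (hΛ : Λ ∈ sandwichKer G) :
    (Λ * gram G Φ).trace.re = 0 := by
  rw [re_trace_mul_gram (BddMeas.of_continuous hG) hΦ]
  have : ∀ θ, (G θ)ᴴ * Λ * G θ = 0 := hΛ.2
  simp [this]

/-- The first order condition along a complement of the kernel is the moment equation. -/
theorem gram_candidate_eq (hG : Continuous G) (hΨ : IsSpectralDensity Ψ)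
    {V : Submodule ℝ (Matrix (Fin n) (Fin n) ℂ)}
    (hV : ∀ Λ : Matrix (Fin n) (Fin n) ℂ, Λ.IsHermitian →
        ∃ Λ₁ ∈ V, ∃ Λ₂ ∈ sandwichKer G, Λ = Λ₁ + Λ₂)
    {S Λ : Matrix (Fin n) (Fin n) ℂ} (hSH : S.IsHermitian)
    (hSker : ∀ Δ ∈ sandwichKer G, (Δ * S).trace.re = 0) {η : ℝ} (hη : 0 < η)
    (hΛ : ∀ θ, LowerBound η (pencil G Λ θ))
    (hcrit : ∀ Δ ∈ V, (Δ * (S - gram G (candidate G Ψ Λ))).trace.re = 0) :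
    gram G (candidate G Ψ Λ) = S := by
  have hH : (S - gram G (candidate G Ψ Λ)).IsHermitian :=
    hSH.sub (isHermitian_gram (isSpectralDensity_candidate hG hΨ hη hΛ).hermitian)
  -- The residual is Hermitian and serves as its own test matrix: the `V` part pairs to zero by
  -- criticality, the kernel part by `hSker`, so its Frobenius norm vanishes.
  obtain ⟨Λ₁, h₁, Λ₂, h₂, he⟩ := hV _ hH
  have h0 : ((S - gram G (candidate G Ψ Λ)) * (S - gram G (candidate G Ψ Λ))).trace.re = 0 := by
    have h2 : (Λ₂ * (S - gram G (candidate G Ψ Λ))).trace.re = 0 := by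
      rw [mul_sub, Matrix.trace_sub, Complex.sub_re, hSker _ h₂,
        re_trace_mul_gram_eq_zero hG (bddMeas_candidate hG hΨ.bddMeas hη hΛ) h₂, sub_zero]
    have h3 : ∀ X, X = Λ₁ + Λ₂ →
        (X * (S - gram G (candidate G Ψ Λ))).trace.re = 0 := by
      rintro _ rfl
      rw [add_mul, Matrix.trace_add, Complex.add_re, hcrit _ h₁, h2, add_zero]
    exact h3 _ he
  have h1 := norm_sq_eq_re_trace (S - gram G (candidate G Ψ Λ))
  rw [hH, h0] at h1
  exact (sub_eq_zero.1 (norm_eq_zero.1 (pow_eq_zero_iff two_ne_zero |>.1 h1))).symm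

theorem isHermitian_of_mem_rangeGamma {S : Matrix (Fin n) (Fin n) ℂ} (hS : S ∈ rangeGamma A B) :
    S.IsHermitian := by
  obtain ⟨Φ, hΦ, rfl⟩ := hS
  exact isHermitian_gram (G := circleTransfer A B) (.of_forall hΦ)

theorem re_trace_mul_eq_zero_of_mem_rangeGamma (hA : IsStabilityMatrix A)
    {S : Matrix (Fin n) (Fin n) ℂ} (hS : S ∈ rangeGamma A B) {Λ : Matrix (Fin n) (Fin n) ℂ}
    (hΛ : Λ ∈ sandwichKer (circleTransfer A B)) : (Λ * S).trace.re = 0 := by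
  obtain ⟨Φ, -, rfl⟩ := hS
  exact re_trace_mul_gram_eq_zero (continuous_circleTransfer hA)
    (BddMeas.of_continuous Φ.continuous) hΛ

theorem add_mem_rangeGamma (hA : IsStabilityMatrix A) {S D : Matrix (Fin n) (Fin n) ℂ}
    (hS : S ∈ rangeGamma A B) (hD : D ∈ rangeGamma A B) : S + D ∈ rangeGamma A B := by
  obtain ⟨Φ₁, h₁, rfl⟩ := hS
  obtain ⟨Φ₂, h₂, rfl⟩ := hD
  refine ⟨Φ₁ + Φ₂, fun θ => (h₁ θ).add (h₂ θ), ?_⟩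
  have bG := BddMeas.of_continuous (continuous_circleTransfer (B := B) hA)
  have b₁ := (bG.mul (BddMeas.of_continuous Φ₁.continuous)).mul bG.conjTranspose
  have b₂ := (bG.mul (BddMeas.of_continuous Φ₂.continuous)).mul bG.conjTranspose
  refine Eq.trans ?_ (matIntegral_add b₁ b₂)
  refine matIntegral_congr fun θ => ?_
  rw [ContinuousMap.add_apply, Matrix.mul_add, Matrix.add_mul]

theorem exists_add_mem_posGamma (hA : IsStabilityMatrix A) {S : Matrix (Fin n) (Fin n) ℂ}
    (hS : S ∈ posGamma A B) :
    ∃ δ : ℝ, 0 < δ ∧ ∀ D ∈ rangeGamma A B, ‖D‖ < δ → S + D ∈ posGamma A B := by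
  obtain ⟨p, hp, hpS⟩ := exists_lowerBound_of_posDef hS.2
  refine ⟨p / 2 / (n + 1), by positivity, fun D hD hδ => ⟨add_mem_rangeGamma hA hS.1 hD, ?_⟩⟩
  refine LowerBound.posDef (half_pos hp) (hpS.add (isHermitian_of_mem_rangeGamma hD) ?_)
  rw [lt_div_iff₀ (by positivity)] at hδ
  linarith [norm_nonneg D]

/-- Upgrades convergence of the finite-dimensional multiplier to `L^∞` convergence of the density;
uniform since `‖Q⁻¹‖ ≤ m/η` throughout. -/
theorem exists_norm_candidate_sub_le (hG : Continuous G) (hΨ : BddMeas Ψ) {η : ℝ} (hη : 0 < η) :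
    ∃ C : ℝ, 0 < C ∧ ∀ Λ₀ Λ₁ : Matrix (Fin n) (Fin n) ℂ,
      (∀ θ, LowerBound η (pencil G Λ₀ θ)) → (∀ θ, LowerBound η (pencil G Λ₁ θ)) →
      ∀ᵐ θ ∂circleMeasure, ‖candidate G Ψ Λ₁ θ - candidate G Ψ Λ₀ θ‖ ≤ C * ‖Λ₁ - Λ₀‖ := by
  obtain ⟨K, hK, hKG⟩ := exists_norm_sandwich_le hG
  obtain ⟨C, hC⟩ := hΨ.2
  have hC0 : 0 ≤ C := by
    obtain ⟨θ, hθ⟩ := hC.exists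
    exact (norm_nonneg _).trans hθ
  refine ⟨2 * (m / η * K * (m / η) * C * (m / η)) + 1, by positivity, fun Λ₀ Λ₁ h₀ h₁ => ?_⟩
  filter_upwards [hC] with θ h
  have e₀ := (h₀ θ).norm_inv_le hη
  have e₁ := (h₁ θ).norm_inv_le hη
  have eD := hKG (Λ₁ - Λ₀) θ
  have hd := inv_sub_inv_eq ((h₀ θ).isUnit_det hη) ((h₁ θ).isUnit_det hη)
  rw [pencil_sub_pencil] at hd
  have hdn : ‖(pencil G Λ₁ θ)⁻¹ - (pencil G Λ₀ θ)⁻¹‖ ≤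
      m / η * (K * ‖Λ₁ - Λ₀‖) * (m / η) := by
    rw [hd, norm_neg]
    refine (norm_mul_le _ _).trans ?_
    gcongr
    refine (norm_mul_le _ _).trans ?_
    gcongr
  have hsplit : candidate G Ψ Λ₁ θ - candidate G Ψ Λ₀ θ =
      ((pencil G Λ₁ θ)⁻¹ - (pencil G Λ₀ θ)⁻¹) * Ψ θ * (pencil G Λ₁ θ)⁻¹ +
      (pencil G Λ₀ θ)⁻¹ * Ψ θ * ((pencil G Λ₁ θ)⁻¹ - (pencil G Λ₀ θ)⁻¹) := by
    rw [candidate, candidate, sub_mul, sub_mul, mul_sub]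
    abel
  have hb1 : ‖((pencil G Λ₁ θ)⁻¹ - (pencil G Λ₀ θ)⁻¹) * Ψ θ * (pencil G Λ₁ θ)⁻¹‖ ≤
      m / η * (K * ‖Λ₁ - Λ₀‖) * (m / η) * C * (m / η) := by
    refine (norm_mul_le _ _).trans ?_
    gcongr
    refine (norm_mul_le _ _).trans ?_
    gcongr
  have hb2 : ‖(pencil G Λ₀ θ)⁻¹ * Ψ θ * ((pencil G Λ₁ θ)⁻¹ - (pencil G Λ₀ θ)⁻¹)‖ ≤
      m / η * C * (m / η * (K * ‖Λ₁ - Λ₀‖) * (m / η)) := by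
    refine (norm_mul_le _ _).trans ?_
    gcongr
    refine (norm_mul_le _ _).trans ?_
    gcongr
  rw [hsplit]
  refine (norm_add_le _ _).trans ((add_le_add hb1 hb2).trans ?_)
  linarith [norm_nonneg (Λ₁ - Λ₀)]

theorem hellinger_wellPosed (hA : IsStabilityMatrix A) (hB : B.rank = m)
    (hΨ : IsSpectralDensity Ψ) :
    ∀ S ∈ posGamma A B,
      (∃ Φ, IsHellingerSolution A B Ψ S Φ) ∧
      (∀ Φ₁ Φ₂, IsHellingerSolution A B Ψ S Φ₁ →
        IsHellingerSolution A B Ψ S Φ₂ →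
        Φ₁ =ᵐ[circleMeasure] Φ₂) ∧
      (∀ Φ, IsHellingerSolution A B Ψ S Φ →
        ∀ ε : ℝ, 0 < ε → ∃ δ : ℝ, 0 < δ ∧
          ∀ D ∈ rangeGamma A B, frobenius D < δ →
            S + D ∈ posGamma A B ∧
            ∀ Φ', IsHellingerSolution A B Ψ (S + D) Φ' →
              distLinfty Φ' Φ < ENNReal.ofReal ε) := by
  intro S hS
  have hG : Continuous (circleTransfer A B) := continuous_circleTransfer hA
  obtain ⟨L, hL, hGL⟩ := exists_lipschitz_circleTransfer hA B
  obtain ⟨c, hc, hΨc⟩ := hΨ.exists_lowerBound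
  obtain ⟨V, hVH, hV0, hVker⟩ := exists_complement_sandwichKer (circleTransfer A B)
  -- Coercivity of `Φ₀` is what bounds the dual sublevel sets; the continuous density that places
  -- `S` in the range need not be positive.
  obtain ⟨Φ₀, hΦ₀, rfl⟩ := exists_isSpectralDensity_gram_eq hA hB hS
  obtain ⟨c₀, hc₀, hΦ₀c⟩ := hΦ₀.exists_lowerBound
  obtain ⟨Λ, hΛV, η, hη, hΛ, hcrit⟩ := exists_critical hG hL hGL hΨ.bddMeas hc hΨc hVH hV0
    hΦ₀.bddMeas hc₀ hΦ₀c
  have hmom := gram_candidate_eq hG hΨ hVker (isHermitian_of_mem_rangeGamma hS.1)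
    (fun Δ hΔ => re_trace_mul_eq_zero_of_mem_rangeGamma hA hS.1 hΔ) hη hΛ hcrit
  refine ⟨⟨_, isHellingerSolution_candidate hG hΨ hη hΛ hmom⟩, fun Φ₁ Φ₂ h₁ h₂ =>
    (h₁.ae_eq_candidate hG hΨ hη hΛ hmom).trans (h₂.ae_eq_candidate hG hΨ hη hΛ hmom).symm,
    fun Φ hΦ ε hε => ?_⟩
  have hΦe := hΦ.ae_eq_candidate hG hΨ hη hΛ hmom
  have hη2 := half_pos hη
  obtain ⟨C, hC, hCΨ⟩ := exists_norm_candidate_sub_le hG hΨ.bddMeas hη2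
  obtain ⟨δ₁, hδ₁, hpos⟩ := exists_add_mem_posGamma hA hS
  obtain ⟨δ₂, hδ₂, hnear⟩ := exists_critical_near hG hΨ.bddMeas hc hΨc hVH hV0 hΛV hη hΛ hcrit
    -- Within this distance of `Λ`, the Lipschitz constant `C` gives an a.e. bound `ε / 2`, leaving
    -- room for the strict inequality on the essential supremum.
    (ε := ε / 2 / C) (by positivity)
  refine ⟨min δ₁ δ₂, lt_min hδ₁ hδ₂, fun D hD hDδ => ?_⟩
  rw [frobenius_eq_norm] at hDδ
  have hSD := hpos D hD (hDδ.trans_le (min_le_left _ _))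
  refine ⟨hSD, fun Φ' hΦ' => ?_⟩
  obtain ⟨Λ', -, hdist, hΛ', hcrit'⟩ := hnear D (hDδ.trans_le (min_le_right _ _))
  have hmom' := gram_candidate_eq hG hΨ hVker (isHermitian_of_mem_rangeGamma hSD.1)
    (fun Δ hΔ => re_trace_mul_eq_zero_of_mem_rangeGamma hA hSD.1 hΔ) hη2 hΛ' hcrit'
  have hΦe' := hΦ'.ae_eq_candidate hG hΨ hη2 hΛ' hmom'
  have hb : ∀ᵐ θ ∂circleMeasure, ‖frobenius (Φ' θ - Φ θ)‖ ≤ ε / 2 := by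
    filter_upwards [hΦe, hΦe', hCΨ Λ Λ' (fun θ => (hΛ θ).mono (by linarith)) hΛ'] with θ h1 h2 h3
    rw [h1, h2, frobenius_eq_norm, norm_norm]
    refine h3.trans ?_
    rw [le_div_iff₀ hC] at hdist
    linarith
  calc distLinfty Φ' Φ ≤ ENNReal.ofReal (ε / 2) := by
        rw [distLinfty, eLpNorm_exponent_top]
        exact eLpNormEssSup_le_of_ae_bound hb
    _ < ENNReal.ofReal ε := (ENNReal.ofReal_lt_ofReal_iff hε).2 (by linarith)

end WellPosedness

end SpectrumApprox
end

/-- Hadamard well-posedness of multivariable Hellinger approximation: existence of a solution,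
its uniqueness, and its continuous dependence on the datum for perturbations in the range. -/
theorem mainTheorem7 (n m : ℕ) (A : Matrix (Fin n) (Fin n) ℂ) (B : Matrix (Fin n) (Fin m) ℂ)
    (hA : SpectrumApprox.IsStabilityMatrix A) (hB : B.rank = m)
    (hAB : SpectrumApprox.IsReachable A B)
    (Ψ : SpectrumApprox.Torus → Matrix (Fin m) (Fin m) ℂ)
    (hΨ : SpectrumApprox.IsSpectralDensity Ψ) :
    ∀ S ∈ SpectrumApprox.posGamma A B,
      (∃ Φ, SpectrumApprox.IsHellingerSolution A B Ψ S Φ) ∧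
      (∀ Φ₁ Φ₂, SpectrumApprox.IsHellingerSolution A B Ψ S Φ₁ →
        SpectrumApprox.IsHellingerSolution A B Ψ S Φ₂ →
        Φ₁ =ᵐ[SpectrumApprox.circleMeasure] Φ₂) ∧
      (∀ Φ, SpectrumApprox.IsHellingerSolution A B Ψ S Φ →
        ∀ ε : ℝ, 0 < ε → ∃ δ : ℝ, 0 < δ ∧
          ∀ D ∈ SpectrumApprox.rangeGamma A B, SpectrumApprox.frobenius D < δ →
            S + D ∈ SpectrumApprox.posGamma A B ∧
            ∀ Φ', SpectrumApprox.IsHellingerSolution A B Ψ (S + D) Φ' →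
              SpectrumApprox.distLinfty Φ' Φ < ENNReal.ofReal ε) :=
  SpectrumApprox.hellinger_wellPosed hA hB hΨ
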